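/- **Conventions.** A *metric group* is a group $G$ with a complete bi-invariant metric $d$ of bounded diameter. $\mathbf H$ ranges over infinite-dimensional real Hilbert spaces, $B_n=\{x\in\mathbf H:\|x\|\le n\}$, and $I_{mn}:B_m\to B_n$ is the inclusion. An *affine isometric action* of $G$ on $\mathbf H$ is a homomorphism from $G$ to the group of surjective affine isometries of $\mathbf H$, written $(g,x)\mapsto g\circ x$; no continuity is presupposed. Put $a\mathbin{\dot-}b=\max(a-b,0)$. A *continuity modulus* is a function $\gamma:(0,\infty)\to(0,\infty)$; a real function $f$ on a metric space has modulus $\gamma$ if $d(x,x')<\gamma(\varepsilon)$ implies $|f(x)-f(x')|<\varepsilon$ for all $\varepsilon>0$. *The function $\mathsf{ort}^H$.* $\mathsf{ort}^H(m)$ is the least natural number $n>m$ such that for all $0<\varepsilon<\frac12$ and all $v,v_1,v_2\in\mathbf H$: (i) if $\min(\|v_1\|,\|v_2\|)\ge n$, $\|v\|\le m$ and $\|v_1-v_2\|<\varepsilon$, then $\|v_1'-v_2'\|<2\varepsilon$ whenever $v_i'\in[v,v_i]$ and $\|v_i'\|=n$ $(i=1,2)$; (ii) if $\max(\|v_1\|,\|v_2\|)\le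 m$, $\|v\|>n$ and $\|v_1-v_2\|<\varepsilon$, then $\|v_1'-v_2'\|<2\varepsilon$ whenever $v_i'\in[v,v_i]$ and $\|v_i'\|=n$ $(i=1,2)$; (iii) if $\|v_1\|\ge n$, $\|v_2\|\le m$, $\|v\|=n$, $v\in[v_1,v_2]$ and $\|v_1\|\le n+\varepsilon$, then $\|v_1-v\|\le2\varepsilon$. (This does not depend on the choice of the infinite-dimensional space $\mathbf H$.) *Structures.* We consider many-sorted structures that consist of a group $G$ with a metric, of the balls $(B_n)_{n\in\mathbb N}$ of a real Hilbert space $\mathbf H$ with its usual operations, and of predicates $\circ_{mn}:G\times B_m\times B_m\to\mathbb R$ for all $m,n$ with $\mathsf{ort}^H(m)<n$. For an affine isometric action of $G$ on $\mathbf H$, $A(G,\mathbf H)$ is the structure with $\circ_{mn}(g,x,y)=\mathrm{length}([g\circ x,y]\cap B_n)$. *The class $\mathcal K_{iso\mathbf H}(\mathsf{gth},\mathsf{ort}^H,\gamma^{m,n}_G)$*, where $\mathsf{gth}:\mathbb N\times[0,1)\to\mathbb N$ and the $\gamma^{m,n}_G$ are continuity moduli, consists of the structures in which $G$ is a metric group,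 $\mathbf H$ is an infinite-dimensional real Hilbert space, each $\circ_{mn}$ takes values in $[0,m+n]$, has modulus $\gamma^{m,n}_G$ in the $G$-variable, changes by less than $3\varepsilon$ if one $B_m$-variable is changed by less than $\varepsilon$, and the following axioms hold (for all $m,n,\dots$ such that only predicates $\circ_{mn}$ with $\mathsf{ort}^H(m)<n$ occur; $g,g'$ range over $G$, all other variables over $B_m$; $\delta$ over $\mathbb Q\cap[0,1)$): 1(a) $\sup_{g,x}\min(\circ_{ms}(g,x,0)\mathbin{\dot-}n,\ \delta\mathbin{\dot-}d(1,g))=0$ if $\mathsf{gth}(m,\delta)\le n<s$; 1(b) $\sup_{g,x,y}\min(|\circ_{ms}(g,x,y)-\circ_{m't}(g,I_{mm'}(x),I_{mm'}(y))|,\ \delta\mathbin{\dot-}d(1,g))=0$ if $m<m'$, $\mathsf{gth}(m,\delta)<s<t$ and $\mathsf{gth}(m',\delta)<t$; 1(c) $\sup_{g,x}\min\big(m\mathbin{\dot-}\circ_{mn}(g,x,0),\ \inf_z\max(\circ_{mn}(g,x,z),\sup_u\min(|d(u,z)-\circ_{mn}(g,x,u)|,\ m\mathbin{\dot-}d(0,u)))\big)=0$;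 2(a) $\sup_{g,x,y_1,y_2}\min\big(d(y_1,y_2)\mathbin{\dot-}(\circ_{mn}(g,x,y_1)+\circ_{mn}(g,x,y_2)),\ m\mathbin{\dot-}\circ_{mn}(g,x,0)\big)=0$ and $\sup_{g,x,y_1,y_2}\min\big(\circ_{mn}(g,x,y_1)\mathbin{\dot-}(d(y_1,y_2)+\circ_{mn}(g,x,y_2)),\ m\mathbin{\dot-}\circ_{mn}(g,x,0)\big)=0$; 2(b) $\sup_{g,x_1,x_2}\min\big(\sup_y(d(x_1,x_2)\mathbin{\dot-}(\circ_{mn}(g,x_1,y)+\circ_{mn}(g,x_2,y))),\ m\mathbin{\dot-}\circ_{mn}(g,x_1,0),\ m\mathbin{\dot-}\circ_{mn}(g,x_2,0)\big)=0$; 2(c) $\sup_{g,x_1,x_2}\min\big(\inf_y((\circ_{mn}(g,x_1,y)+\circ_{mn}(g,x_2,y))\mathbin{\dot-}d(x_1,x_2)),\ m\mathbin{\dot-}\circ_{mn}(g,x_1,0),\ m\mathbin{\dot-}\circ_{mn}(g,x_2,0)\big)=0$; 3(a) $\sup_{x,y}|\circ_{mn}(1,x,y)-d(x,y)|=0$;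 3(b) $\sup_{g,x,y}\min\big(|\circ_{mn}(g,x,y)-\circ_{mn}(g^{-1},y,x)|,\ m\mathbin{\dot-}\circ_{mn}(g,x,0),\ m\mathbin{\dot-}\circ_{mn}(g^{-1},y,0)\big)=0$; 3(c) $\sup_{x,y,g,g'}\min\big(\sup_z(\circ_{mn}(gg',x,y)\mathbin{\dot-}(\circ_{mn}(g^{-1},y,z)+\circ_{mn}(g',x,z))),\ m\mathbin{\dot-}\circ_{mn}(g^{-1},y,0),\ m\mathbin{\dot-}\circ_{mn}(g',x,0),\ m\mathbin{\dot-}\circ_{mn}(gg',x,0)\big)=0$. *The axioms $\Theta^{H,s}_{m,n}$.* For $s:\mathbb N\to\mathbb N\setminus\{0\}$ and $\mathsf{ort}^H(m)<n$, $$\Theta^{H,s}_{m,n}:\qquad \inf_{g\in G}\ \sup_{v\in B_m}\Big(\tfrac1{s(m)}\mathbin{\dot-}\circ_{mn}(g,v,v)\Big)=0 .$$ *Non-FH.* A metric group $G$ has *property non-FH in $\mathcal K_{iso\mathbf H}(\mathsf{gth},\mathsf{ort}^H,\gamma^{m,n}_G)$* if it has an affine isometric action without fixed points on some $\mathbf H$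 with $A(G,\mathbf H)\in\mathcal K_{iso\mathbf H}(\mathsf{gth},\mathsf{ort}^H,\gamma^{m,n}_G)$. An affine isometric action of $G$ on $\mathbf H$ *witnesses uniform non-FH* if it has no fixed points; there is $\mathsf{gth}:\mathbb N\times[0,1)\to\mathbb N$, nondecreasing in the first argument, such that $g\circ B_m\subseteq B_{\mathsf{gth}(m,\delta)}$ for all $m$, all $\delta\in[0,1)$ and all $g$ with $d(1,g)\le\delta$; and for all $m,n$ with $\mathsf{ort}^H(m)<n$ there is a continuity modulus $\tilde\gamma$ such that $d(g,g')<\tilde\gamma(\varepsilon)$ implies $\|g\circ x-g'\circ x\|<\varepsilon$ for all $\varepsilon>0$, $g,g'\in G$ and $x\in B_m$ with $g\circ x,g'\circ x\in B_n$. A metric group has *uniform property non-FH* if it has such an action; the structure $A(G,\mathbf H)$ of such an action is said to witness uniform non-FH. A class of structures is *bountiful* if for every infinite structure $M$ in it and every infinite subset $C$ of (the disjoint union of the sorts of) $M$ there is a substructure $K\le M$ in the class that contains $C$ and has the same density character as $C$. (A substructure lives on a subgroup of $G$ and on the balls of a linear subspace of $\mathbf H$.) **Theorem.** (a) Every metric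 group with property non-FH in $\mathcal K_{iso\mathbf H}(\mathsf{gth},\mathsf{ort}^H,\gamma^{m,n}_G)$ has an expansion to a structure $A(G,\mathbf H)$ of an affine isometric action that belongs to $\mathcal K_{iso\mathbf H}(\mathsf{gth},\mathsf{ort}^H,\gamma^{m,n}_G)$ and, for some $s:\mathbb N\to\mathbb N\setminus\{0\}$, satisfies all $\Theta^{H,s}_{m,n}$ with $\mathsf{ort}^H(m)<n$. (b) For every metric group with uniform property non-FH there are a function $\mathsf{gth}:\mathbb N\times[0,1)\to\mathbb N$, nondecreasing in the first argument, and continuity moduli $\gamma^{m,n}_G$ such that the group has an expansion to a structure $A(G,\mathbf H)$ of an affine isometric action that belongs to $\mathcal K_{iso\mathbf H}(\mathsf{gth},\mathsf{ort}^H,\gamma^{m,n}_G)$ and, for some $s:\mathbb N\to\mathbb N\setminus\{0\}$, satisfies all $\Theta^{H,s}_{m,n}$ with $\mathsf{ort}^H(m)<n$. (c) The class of structures $A(G,\mathbf H)$ witnessing uniform non-FH is bountiful. -/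

import Mathlib

universe u v

namespace NonFH

/-! ### Truncated subtraction, balls, metric groups -/

/-- Truncated subtraction of reals, the connective `max (a - b, 0)` of continuous logic. -/
def tsub (a b : ℝ) : ℝ := max (a - b) 0

infixl:65 " ∸ " => tsub

/-- The sort `B_n`: the closed ball of radius `n` around the origin. -/
abbrev Ball (H : Type v) [NormedAddCommGroup H] (n : ℕ) : Type v :=
  Metric.closedBall (0 : H) (n : ℝ)

/-- The distinguished constant `0` of the sort `B_n`. -/
def Ball.zero {H : Type v} [NormedAddCommGroup H] (n : ℕ) : Ball H n :=
  ⟨0, Metric.mem_closedBall_self n.cast_nonneg⟩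

/-- The inclusion map `I_{mn} : B_m → B_n`. -/
def Ball.incl {H : Type v} [NormedAddCommGroup H] {m n : ℕ} (h : m ≤ n) (x : Ball H m) :
    Ball H n :=
  ⟨x.1, Metric.closedBall_subset_closedBall (Nat.cast_le.mpr h) x.2⟩

/-- The `n`-ball of a linear subspace, as a part of the `n`-ball of the whole space. -/
def Ball.up {H : Type v} [NormedAddCommGroup H] [InnerProductSpace ℝ H] {H₀ : Submodule ℝ H}
    {n : ℕ} (x : Ball H₀ n) : Ball H n :=
  ⟨(x.1 : H), by
    have h : ‖x.1‖ ≤ (n : ℝ) := mem_closedBall_zero_iff.mp x.2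
    exact mem_closedBall_zero_iff.mpr h⟩

/-- A metric group of bounded diameter which is a continuous structure:
the metric is complete, bi-invariant and bounded. -/
structure IsMetricGroup (G : Type u) [Group G] [MetricSpace G] : Prop where
  dist_mul_left : ∀ a g h : G, dist (a * g) (a * h) = dist g h
  dist_mul_right : ∀ a g h : G, dist (g * a) (h * a) = dist g h
  complete : CompleteSpace G
  bounded : ∃ D : ℝ, ∀ g h : G, dist g h ≤ D

/-- An infinite-dimensional real Hilbert space. -/
structure IsHilbert (H : Type v) [NormedAddCommGroup H] [InnerProductSpace ℝ H] : Prop where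
  complete : CompleteSpace H
  infinite_dim : ¬ FiniteDimensional ℝ H

/-! ### Continuity moduli -/

/-- `γ` takes positive values at positive arguments. -/
def IsModulus (γ : ℝ → ℝ) : Prop := ∀ ε > 0, 0 < γ ε

/-- The real function `f` on a metric space has continuity modulus `γ`. -/
def HasModulus {X : Type*} [MetricSpace X] (γ : ℝ → ℝ) (f : X → ℝ) : Prop :=
  ∀ ε > 0, ∀ x x' : X, dist x x' < γ ε → |f x - f x'| < ε

/-- The map of moduli that says that a change of the argument by less than `ε` changes the value
by less than `3 * ε`. -/
noncomputable def threeId (ε : ℝ) : ℝ := ε / 3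

/-! ### The function `ort` of Hilbert space -/

/-- The three geometric conditions on the numbers `m < n`, in the real inner product space `H`. -/
structure OrtCondition (H : Type v) [NormedAddCommGroup H] [InnerProductSpace ℝ H]
    (m n : ℕ) : Prop where
  lt : m < n
  outer : ∀ ε : ℝ, 0 < ε → ε < 1 / 2 → ∀ v v₁ v₂ : H,
    (n : ℝ) ≤ min ‖v₁‖ ‖v₂‖ → ‖v‖ ≤ m → ‖v₁ - v₂‖ < ε →
    ∀ w₁ ∈ segment ℝ v v₁, ∀ w₂ ∈ segment ℝ v v₂, ‖w₁‖ = n → ‖w₂‖ = n → ‖w₁ - w₂‖ < 2 * ε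
  inner : ∀ ε : ℝ, 0 < ε → ε < 1 / 2 → ∀ v v₁ v₂ : H,
    max ‖v₁‖ ‖v₂‖ ≤ m → (n : ℝ) < ‖v‖ → ‖v₁ - v₂‖ < ε →
    ∀ w₁ ∈ segment ℝ v v₁, ∀ w₂ ∈ segment ℝ v v₂, ‖w₁‖ = n → ‖w₂‖ = n → ‖w₁ - w₂‖ < 2 * ε
  cross : ∀ ε : ℝ, 0 < ε → ε < 1 / 2 → ∀ v v₁ v₂ : H,
    (n : ℝ) ≤ ‖v₁‖ → ‖v₂‖ ≤ m → ‖v‖ = n → v ∈ segment ℝ v₁ v₂ → ‖v₁‖ ≤ n + ε →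
    ‖v₁ - v‖ ≤ 2 * ε

/-- `ortH m` is the least `n` that satisfies the geometric conditions for `m` in real Hilbert
space. They concern three vectors at a time, so that all infinite-dimensional real Hilbert spaces
give the same function; `ℓ²(ℕ, ℝ)` is taken as the representative. -/
noncomputable def ortH (m : ℕ) : ℕ :=
  sInf {n : ℕ | OrtCondition (lp (fun _ : ℕ => ℝ) 2) m n}

/-! ### Affine isometric actions -/

section Actions

variable {G : Type u} [Group G] [MetricSpace G]
  {H : Type v} [NormedAddCommGroup H] [InnerProductSpace ℝ H]

/-- The length of the part of the segment `[a, b]` that lies in the `n`-ball of `0`. That part is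
convex, hence itself a segment (or empty), so that its length is its diameter. -/
noncomputable def lengthInBall (n : ℕ) (a b : H) : ℝ :=
  Metric.diam (segment ℝ a b ∩ Metric.closedBall (0 : H) (n : ℝ))

/-- The predicate `∘_{mn} (g, x, y) = length ([g ∘ x, y] ∩ B_n)` of an action by affine
isometries. -/
noncomputable def circOf (ρ : G →* (H ≃ᵃⁱ[ℝ] H)) (m n : ℕ) (g : G) (x y : Ball H m) : ℝ :=
  lengthInBall n (ρ g x.1) y.1

/-- The action has no (global) fixed point. -/
def NoFixedPoint (ρ : G →* (H ≃ᵃⁱ[ℝ] H)) : Prop := ¬ ∃ x : H, ∀ g : G, ρ g x = x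

/-- `gth : ℕ × [0,1) → ℕ` is increasing with respect to the first argument. Only the values at
real numbers in `[0,1)` are ever used. -/
def IsGrowth (gth : ℕ → ℝ → ℕ) : Prop :=
  ∀ δ : ℝ, 0 ≤ δ → δ < 1 → Monotone fun m => gth m δ

/-- The action corresponds to `gth`: an element at distance at most `δ < 1` from `1` maps `B_m`
into the ball of radius `gth m δ`. -/
def CorrespondsTo (ρ : G →* (H ≃ᵃⁱ[ℝ] H)) (gth : ℕ → ℝ → ℕ) : Prop :=
  ∀ (m : ℕ) (δ : ℝ), 0 ≤ δ → δ < 1 → ∀ g : G, dist 1 g ≤ δ →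
    ∀ x : H, ‖x‖ ≤ m → ‖ρ g x‖ ≤ gth m δ

/-- `γ` is a continuity modulus for the `G`-variable of the partial function `G × B_m → B_n`
induced by the action. -/
def HasPartialModulus (ρ : G →* (H ≃ᵃⁱ[ℝ] H)) (m n : ℕ) (γ : ℝ → ℝ) : Prop :=
  ∀ ε > 0, ∀ (g g' : G) (x : H), ‖x‖ ≤ m → ‖ρ g x‖ ≤ n → ‖ρ g' x‖ ≤ n →
    dist g g' < γ ε → dist (ρ g x) (ρ g' x) < ε

/-- The action witnesses uniform property non-FH. -/
structure WitnessesUniform (ρ : G →* (H ≃ᵃⁱ[ℝ] H)) : Prop where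
  noFixedPoint : NoFixedPoint ρ
  growth : ∃ gth : ℕ → ℝ → ℕ, IsGrowth gth ∧ CorrespondsTo ρ gth
  moduli : ∀ m n : ℕ, ortH m < n → ∃ γ : ℝ → ℝ, IsModulus γ ∧ HasPartialModulus ρ m n γ

end Actions

/-! ### The many-sorted structures -/

/-- A union of a group with a metric and of the many-sorted structure of the `n`-balls of a real
inner product space, with predicates `∘_{mn}` on `G × B_m × B_m`. When a function `ort` is fixed,
only the `∘_{mn}` with `ort m < n` belong to the language; the others are never used. -/
structure GHStructure where
  G : Type u
  [group : Group G]
  [metric : MetricSpace G]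
  H : Type v
  [normed : NormedAddCommGroup H]
  [inner : InnerProductSpace ℝ H]
  circ : (m n : ℕ) → G → Ball H m → Ball H m → ℝ

attribute [instance] GHStructure.group GHStructure.metric GHStructure.normed GHStructure.inner

/-- The structure `A(G,H)` of an action by affine isometries. -/
noncomputable def actionStructure {G : Type u} [Group G] [MetricSpace G]
    {H : Type v} [NormedAddCommGroup H] [InnerProductSpace ℝ H] (ρ : G →* (H ≃ᵃⁱ[ℝ] H)) :
    GHStructure.{u, v} where
  G := G
  H := H
  circ := circOf ρ

namespace GHStructure

/-- Axioms of group 1 for the predicates `∘_{mn}` with `ort m < n`. -/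
structure AxiomsOne (M : GHStructure.{u, v}) (gth : ℕ → ℝ → ℕ) (ort : ℕ → ℕ) : Prop where
  /-- The value `g ∘ x` is eventually defined inside some `B_n`. -/
  a : ∀ (m n s : ℕ) (δ : ℚ), 0 ≤ δ → δ < 1 → ort m < s → gth m δ ≤ n → n < s →
    ⨆ g : M.G, ⨆ x : Ball M.H m,
      min (M.circ m s g x (Ball.zero m) ∸ n) ((δ : ℝ) ∸ dist 1 g) = 0
  /-- Correctness. -/
  b : ∀ (m m' s t : ℕ) (δ : ℚ) (hm : m < m'), 0 ≤ δ → δ < 1 → ort m < s → ort m' < t →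
    gth m δ < s → s < t → gth m' δ < t →
    ⨆ g : M.G, ⨆ x : Ball M.H m, ⨆ y : Ball M.H m,
      min |M.circ m s g x y - M.circ m' t g (Ball.incl hm.le x) (Ball.incl hm.le y)|
        ((δ : ℝ) ∸ dist 1 g) = 0
  /-- Approximation of the value `g ∘ x` by points `z`. -/
  c : ∀ m n : ℕ, ort m < n →
    ⨆ g : M.G, ⨆ x : Ball M.H m,
      min ((m : ℝ) ∸ M.circ m n g x (Ball.zero m))
        (⨅ z : Ball M.H m, max (M.circ m n g x z)
          (⨆ w : Ball M.H m, min |dist w z - M.circ m n g x w|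
            ((m : ℝ) ∸ dist (Ball.zero m) w))) = 0

/-- Axioms of group 2 for the predicates `∘_{mn}` with `ort m < n`. -/
structure AxiomsTwo (M : GHStructure.{u, v}) (ort : ℕ → ℕ) : Prop where
  /-- Triangle inequalities involving `g ∘ x`. -/
  a₁ : ∀ m n : ℕ, ort m < n →
    ⨆ g : M.G, ⨆ x : Ball M.H m, ⨆ y₁ : Ball M.H m, ⨆ y₂ : Ball M.H m,
      min (dist y₁ y₂ ∸ (M.circ m n g x y₁ + M.circ m n g x y₂))
        ((m : ℝ) ∸ M.circ m n g x (Ball.zero m)) = 0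
  a₂ : ∀ m n : ℕ, ort m < n →
    ⨆ g : M.G, ⨆ x : Ball M.H m, ⨆ y₁ : Ball M.H m, ⨆ y₂ : Ball M.H m,
      min (M.circ m n g x y₁ ∸ (dist y₁ y₂ + M.circ m n g x y₂))
        ((m : ℝ) ∸ M.circ m n g x (Ball.zero m)) = 0
  /-- The triangle inequality for `g ∘ x₁` and `g ∘ x₂`. -/
  b : ∀ m n : ℕ, ort m < n →
    ⨆ g : M.G, ⨆ x₁ : Ball M.H m, ⨆ x₂ : Ball M.H m,
      min (⨆ y : Ball M.H m, (dist x₁ x₂ ∸ (M.circ m n g x₁ y + M.circ m n g x₂ y)))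
        (min ((m : ℝ) ∸ M.circ m n g x₁ (Ball.zero m))
          ((m : ℝ) ∸ M.circ m n g x₂ (Ball.zero m))) = 0
  /-- The action is isometric. -/
  c : ∀ m n : ℕ, ort m < n →
    ⨆ g : M.G, ⨆ x₁ : Ball M.H m, ⨆ x₂ : Ball M.H m,
      min (⨅ y : Ball M.H m, ((M.circ m n g x₁ y + M.circ m n g x₂ y) ∸ dist x₁ x₂))
        (min ((m : ℝ) ∸ M.circ m n g x₁ (Ball.zero m))
          ((m : ℝ) ∸ M.circ m n g x₂ (Ball.zero m))) = 0

/-- Axioms of group 3 for the predicates `∘_{mn}` with `ort m < n`. -/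
structure AxiomsThree (M : GHStructure.{u, v}) (ort : ℕ → ℕ) : Prop where
  /-- The neutral element acts trivially. -/
  a : ∀ m n : ℕ, ort m < n →
    ⨆ x : Ball M.H m, ⨆ y : Ball M.H m, |M.circ m n 1 x y - dist x y| = 0
  /-- The action of `g⁻¹`. -/
  b : ∀ m n : ℕ, ort m < n →
    ⨆ g : M.G, ⨆ x : Ball M.H m, ⨆ y : Ball M.H m,
      min |M.circ m n g x y - M.circ m n g⁻¹ y x|
        (min ((m : ℝ) ∸ M.circ m n g x (Ball.zero m))
          ((m : ℝ) ∸ M.circ m n g⁻¹ y (Ball.zero m))) = 0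
  /-- If `g' ∘ x = z` and `g ∘ z = y`, then `(g * g') ∘ x = y`. -/
  c : ∀ m n : ℕ, ort m < n →
    ⨆ x : Ball M.H m, ⨆ y : Ball M.H m, ⨆ g : M.G, ⨆ g' : M.G,
      min (⨆ z : Ball M.H m,
          (M.circ m n (g * g') x y ∸ (M.circ m n g⁻¹ y z + M.circ m n g' x z)))
        (min ((m : ℝ) ∸ M.circ m n g⁻¹ y (Ball.zero m))
          (min ((m : ℝ) ∸ M.circ m n g' x (Ball.zero m))
            ((m : ℝ) ∸ M.circ m n (g * g') x (Ball.zero m)))) = 0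

/-- Membership in the class `K_isoH(gth, ort, γ)`. -/
structure InKisoH (M : GHStructure.{u, v}) (gth : ℕ → ℝ → ℕ) (ort : ℕ → ℕ)
    (γ : ℕ → ℕ → ℝ → ℝ) : Prop where
  metricGroup : IsMetricGroup M.G
  hilbert : IsHilbert M.H
  range : ∀ m n : ℕ, ort m < n → ∀ g x y, M.circ m n g x y ∈ Set.Icc (0 : ℝ) (n + m)
  isModulus : ∀ m n : ℕ, ort m < n → IsModulus (γ m n)
  modulus_group : ∀ m n : ℕ, ort m < n → ∀ x y, HasModulus (γ m n) fun g => M.circ m n g x y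
  modulus_left : ∀ m n : ℕ, ort m < n → ∀ g y, HasModulus threeId fun x => M.circ m n g x y
  modulus_right : ∀ m n : ℕ, ort m < n → ∀ g x, HasModulus threeId fun y => M.circ m n g x y
  one : M.AxiomsOne gth ort
  two : M.AxiomsTwo ort
  three : M.AxiomsThree ort

/-- The axiom `Θ^{H,s}_{m,n}`. -/
def Theta (M : GHStructure.{u, v}) (s : ℕ → ℕ) (m n : ℕ) : Prop :=
  ⨅ g : M.G, ⨆ x : Ball M.H m, ((1 / (s m : ℝ)) ∸ M.circ m n g x x) = 0

/-- For some function `s` with positive values, all `Θ^{H,s}_{m,n}` with `ort m < n` hold. -/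
def SatisfiesTheta (M : GHStructure.{u, v}) (ort : ℕ → ℕ) : Prop :=
  ∃ s : ℕ → ℕ, (∀ m, 0 < s m) ∧ ∀ m n : ℕ, ort m < n → M.Theta s m n

/-- The structure `M` is of the form `A(G,H)` for an action that witnesses uniform property
non-FH. -/
def WitnessesUniformNonFH (M : GHStructure.{u, v}) : Prop :=
  IsMetricGroup M.G ∧ IsHilbert M.H ∧
    ∃ ρ : M.G →* (M.H ≃ᵃⁱ[ℝ] M.H), WitnessesUniform ρ ∧
      ∀ m n : ℕ, ortH m < n → ∀ g x y, M.circ m n g x y = circOf ρ m n g x y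

/-- The universe of the many-sorted structure: the disjoint union of all sorts. -/
abbrev Univ (M : GHStructure.{u, v}) : Type (max u v) := M.G ⊕ (Σ n : ℕ, Ball M.H n)

/-- The substructure of `M` on a subgroup and the balls of a linear subspace. -/
noncomputable def restrict (M : GHStructure.{u, v}) (G₀ : Subgroup M.G) (H₀ : Submodule ℝ M.H) :
    GHStructure.{u, v} where
  G := G₀
  H := H₀
  circ m n g x y := M.circ m n g x.up y.up

/-- The universe of the substructure, as a subset of the universe of `M`. -/
def carrier (M : GHStructure.{u, v}) (G₀ : Subgroup M.G) (H₀ : Submodule ℝ M.H) :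
    Set M.Univ :=
  {p | Sum.elim (fun g => g ∈ G₀) (fun q => q.2.1 ∈ H₀) p}

end GHStructure

/-! ### The properties of groups, and bountiful classes -/

/-- `G` has property non-FH in the class `K_isoH(gth, ort, γ)`. -/
def NonFHIn (gth : ℕ → ℝ → ℕ) (ort : ℕ → ℕ) (γ : ℕ → ℕ → ℝ → ℝ)
    (G : Type u) [Group G] [MetricSpace G] : Prop :=
  ∃ (H : Type v) (_ : NormedAddCommGroup H) (_ : InnerProductSpace ℝ H)
    (ρ : G →* (H ≃ᵃⁱ[ℝ] H)),
    NoFixedPoint ρ ∧ (actionStructure ρ).InKisoH gth ort γ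

/-- `G` satisfies uniform property non-FH. -/
def UniformNonFH (G : Type u) [Group G] [MetricSpace G] : Prop :=
  ∃ (H : Type v) (_ : NormedAddCommGroup H) (_ : InnerProductSpace ℝ H)
    (ρ : G →* (H ≃ᵃⁱ[ℝ] H)), IsHilbert H ∧ WitnessesUniform ρ

/-- The density character: the least cardinality of a dense subset. -/
noncomputable def densityCharacter (X : Type u) [TopologicalSpace X] : Cardinal.{u} :=
  sInf {κ | ∃ D : Set X, Dense D ∧ Cardinal.mk D = κ}

/-- A class of structures is bountiful: every infinite subset `C` of an infinite member is
contained in a substructure that belongs to the class and has the density character of `C`. -/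
def Bountiful (K : GHStructure.{u, v} → Prop) : Prop :=
  ∀ M : GHStructure.{u, v}, K M → Infinite M.Univ → ∀ C : Set M.Univ, C.Infinite →
    ∃ (G₀ : Subgroup M.G) (H₀ : Submodule ℝ M.H),
      K (M.restrict G₀ H₀) ∧ C ⊆ M.carrier G₀ H₀ ∧
        densityCharacter (M.carrier G₀ H₀) = densityCharacter C

end NonFH

set_option linter.unusedSectionVars false

/-! The absence of fixed points is used in the form of unbounded orbits: an affine isometric action
on a Hilbert space with a bounded orbit fixes the centre of the smallest ball around that orbit
(`exists_fixedPoint_of_bounded`). So some `g` carries the origin further than `2 * m + 1` and moves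
every point of `B_m` by more than 1. Since `n ≥ m + 1`, at least length 1 of `[g ∘ x, x]` is visible
in `B_n`, and Θ holds with `s = 1` (`NoFixedPoint.satisfiesTheta`). This settles (a) with the given
action.

For (b), the axioms of the class are guarded so that `g ∘ x` lies in `B_n` whenever they say
something; there the predicate is the distance, and they reduce to triangle inequalities and
isometry. The moduli need geometry: `ortH m < n` gives `4 * m ^ 2 ≤ 3 * n ^ 2`, so rays from `B_m`
cross the sphere of radius `n` at an angle at most `π / 3` with the normal. Projections along rays
to the sphere are then 2-Lipschitz, and the visible length is 2-Lipschitz in `g ∘ x` and 3-Lipschitz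
in `y`. Growth and invariance of the metric turn the partial moduli into moduli on all of `G × B_m`
(`WitnessesUniform.exists_modulus`).

Part (c) is a closing-off argument of Löwenheim–Skolem type. A dense subset of `C` is enlarged by
countably many group elements that move the origin arbitrarily far and by an independent sequence of
vectors. The closed subgroup generated and the closed span of the orbits form an invariant
substructure of the same density (`exists_invariant_closed`); the added elements keep it free of
fixed points and infinite-dimensional. -/

namespace NonFH

open scoped RealInnerProductSpace
open TopologicalSpace

/-! ### Rays crossing a sphere, and the numerical meaning of the geometric conditions. -/

section Geometry

variable {H : Type v} [NormedAddCommGroup H] [InnerProductSpace ℝ H]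

/-- The angle at a point `w` of the sphere of radius `n` between the normal and the direction from
a point `v` of a much smaller ball is at most `π / 3`. -/
lemma sq_inner_sub_ge {m n : ℝ} (hmn : 4 * m ^ 2 ≤ 3 * n ^ 2) {v w : H} (hv : ‖v‖ ≤ m)
    (hw : ‖w‖ = n) : n ^ 2 * ‖w - v‖ ^ 2 ≤ 4 * ⟪w - v, w⟫ ^ 2 := by
  have h1 : ‖w - v‖ ^ 2 = n ^ 2 - 2 * ⟪v, w⟫ + ‖v‖ ^ 2 := by
    rw [norm_sub_sq_real, hw, real_inner_comm]
  have h2 : ⟪w - v, w⟫ = n ^ 2 - ⟪v, w⟫ := by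
    rw [inner_sub_left, real_inner_self_eq_norm_sq, hw]
  have h3 : ‖v‖ ^ 2 ≤ m ^ 2 := by gcongr
  have h4 : n ^ 2 * ‖v‖ ^ 2 ≤ n ^ 2 * (3 / 4 * n ^ 2) := by gcongr; linarith
  rw [h1, h2]
  nlinarith [sq_nonneg (3 / 2 * n ^ 2 - 2 * ⟪v, w⟫)]

lemma inner_sub_pos {m n : ℝ} (h : m < n) {v w : H} (hv : ‖v‖ ≤ m) (hw : ‖w‖ = n) :
    0 < ⟪w - v, w⟫ := by
  have h2 : ⟪w - v, w⟫ = n ^ 2 - ⟪v, w⟫ := by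
    rw [inner_sub_left, real_inner_self_eq_norm_sq, hw]
  have h3 := real_inner_le_norm v w
  rw [hw] at h3
  have : 0 < n := (norm_nonneg v).trans_lt (hv.trans_lt h)
  nlinarith

lemma half_norm_le_inner_sub {m n : ℝ} (h : m < n) (hmn : 4 * m ^ 2 ≤ 3 * n ^ 2) {v w : H}
    (hv : ‖v‖ ≤ m) (hw : ‖w‖ = n) : n * ‖w - v‖ ≤ 2 * ⟪w - v, w⟫ := by
  refine le_of_sq_le_sq ?_ (by linarith [inner_sub_pos h hv hw])
  nlinarith [sq_inner_sub_ge hmn hv hw]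

/-- If `a` makes an angle at most `π / 3` with the line of `N`, and `c` has a normal component
opposite to that of `a`, then the angle between `c` and `a` is at least `π / 6`. -/
lemma sq_inner_le_of_opposite {n : ℝ} (hn : 0 < n) {a c N : H} (hN : ‖N‖ = n)
    (h1 : n ^ 2 * ‖a‖ ^ 2 ≤ 4 * ⟪a, N⟫ ^ 2) (h2 : ⟪a, N⟫ * ⟪c, N⟫ ≤ 0) (h3 : 0 ≤ ⟪c, a⟫) :
    4 * ⟪c, a⟫ ^ 2 ≤ 3 * (‖c‖ ^ 2 * ‖a‖ ^ 2) := by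
  set T : H := n ^ 2 • a - ⟪a, N⟫ • N with hT
  have e1 : ⟪c, T⟫ = n ^ 2 * ⟪c, a⟫ - ⟪a, N⟫ * ⟪c, N⟫ := by
    rw [hT, inner_sub_right, inner_smul_right, inner_smul_right]
  have e2 : ‖T‖ ^ 2 = n ^ 4 * ‖a‖ ^ 2 - n ^ 2 * ⟪a, N⟫ ^ 2 := by
    rw [hT, norm_sub_sq_real, norm_smul, norm_smul, inner_smul_left, inner_smul_right, hN]
    simp only [mul_pow, Real.norm_eq_abs, sq_abs, conj_trivial]
    ring
  have e3 : ⟪c, T⟫ ^ 2 ≤ ‖c‖ ^ 2 * ‖T‖ ^ 2 := by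
    have := abs_real_inner_le_norm c T
    rw [← mul_pow, ← sq_abs]
    gcongr
  have e4 : (n ^ 2 * ⟪c, a⟫) ^ 2 ≤ ⟪c, T⟫ ^ 2 := by
    have : 0 ≤ n ^ 2 * ⟪c, a⟫ := by positivity
    gcongr
    linarith
  have e5 : 4 * ‖T‖ ^ 2 ≤ 3 * n ^ 4 * ‖a‖ ^ 2 := by nlinarith [sq_nonneg n]
  have e6 : n ^ 4 * (4 * ⟪c, a⟫ ^ 2) ≤ n ^ 4 * (3 * (‖c‖ ^ 2 * ‖a‖ ^ 2)) := by
    have := mul_le_mul_of_nonneg_left e5 (sq_nonneg ‖c‖)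
    nlinarith
  exact le_of_mul_le_mul_left e6 (by positivity)

/-- At an angle of at least `π / 6` the distance from `c` to the ray along `a` is at least `‖c‖ *
sin (π / 6)`; at a right or obtuse angle the nearest point of the ray is its origin. -/
lemma norm_le_two_mul_of_angle {a c : H} {τ : ℝ} (hτ : 0 ≤ τ)
    (h : 0 < ⟪c, a⟫ → 4 * ⟪c, a⟫ ^ 2 ≤ 3 * (‖c‖ ^ 2 * ‖a‖ ^ 2)) :
    ‖c‖ ≤ 2 * ‖c - τ • a‖ := by
  have e : ‖c - τ • a‖ ^ 2 = ‖c‖ ^ 2 - 2 * τ * ⟪c, a⟫ + τ ^ 2 * ‖a‖ ^ 2 := by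
    rw [norm_sub_sq_real, norm_smul, inner_smul_right, mul_pow, Real.norm_eq_abs, sq_abs]
    ring
  refine le_of_sq_le_sq ?_ (by positivity)
  rw [mul_pow, e]
  by_cases hX : 0 < ⟪c, a⟫
  · have h := h hX
    have ha : 0 < ‖a‖ ^ 2 := by
      have : a ≠ 0 := by rintro rfl; simp at hX
      positivity
    have : 0 ≤ (3 * ‖c‖ ^ 2 - 8 * τ * ⟪c, a⟫ + 4 * τ ^ 2 * ‖a‖ ^ 2) * ‖a‖ ^ 2 := by
      nlinarith [sq_nonneg (2 * τ * ‖a‖ ^ 2 - 2 * ⟪c, a⟫)]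
    have := nonneg_of_mul_nonneg_left this ha
    linarith
  · have : 0 ≤ τ * -⟪c, a⟫ := mul_nonneg hτ (by linarith)
    nlinarith [sq_nonneg ‖c‖, mul_nonneg (sq_nonneg τ) (sq_nonneg ‖a‖)]

/-- Division by `s₁ ≥ 1` turns the right-hand difference into `a₁ - a₂` minus a nonnegative multiple
of `a₂`, so the distance to a ray applies. -/
lemma norm_sub_le_two_mul_of_le {a₁ a₂ : H} {s₁ s₂ : ℝ} (hs : 1 ≤ s₁) (hss : s₁ ≤ s₂)
    (h : 0 < ⟪a₁ - a₂, a₂⟫ →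
      4 * ⟪a₁ - a₂, a₂⟫ ^ 2 ≤ 3 * (‖a₁ - a₂‖ ^ 2 * ‖a₂‖ ^ 2)) :
    ‖a₁ - a₂‖ ≤ 2 * ‖s₁ • a₁ - s₂ • a₂‖ := by
  have h0 : 0 < s₁ := by linarith
  have key := norm_le_two_mul_of_angle (τ := s₂ / s₁ - 1)
    (by rw [sub_nonneg, one_le_div h0]; exact hss) h
  have e : s₁ • a₁ - s₂ • a₂ = s₁ • (a₁ - a₂ - (s₂ / s₁ - 1) • a₂) := by
    have : s₁ * (s₂ / s₁) = s₂ := by field_simp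
    simp only [smul_sub, sub_smul, smul_smul, one_smul, this]
    abel
  rw [e, norm_smul, Real.norm_eq_abs, abs_of_pos h0]
  nlinarith [norm_nonneg (a₁ - a₂ - (s₂ / s₁ - 1) • a₂)]

/-- Comparison of points on two rays that start at one point. -/
lemma norm_sub_le_two_mul {a₁ a₂ : H} {s₁ s₂ : ℝ} (hs₁ : 1 ≤ s₁) (hs₂ : 1 ≤ s₂)
    (h₂ : 0 < ⟪a₁ - a₂, a₂⟫ → 4 * ⟪a₁ - a₂, a₂⟫ ^ 2 ≤ 3 * (‖a₁ - a₂‖ ^ 2 * ‖a₂‖ ^ 2))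
    (h₁ : 0 < ⟪a₂ - a₁, a₁⟫ → 4 * ⟪a₂ - a₁, a₁⟫ ^ 2 ≤ 3 * (‖a₂ - a₁‖ ^ 2 * ‖a₁‖ ^ 2)) :
    ‖a₁ - a₂‖ ≤ 2 * ‖s₁ • a₁ - s₂ • a₂‖ := by
  rcases le_total s₁ s₂ with h | h
  · exact norm_sub_le_two_mul_of_le hs₁ h h₂
  · rw [norm_sub_rev, norm_sub_rev (s₁ • a₁)]
    exact norm_sub_le_two_mul_of_le hs₂ h h₁

lemma inner_chord {n : ℝ} {w₁ w₂ : H} (h₁ : ‖w₁‖ = n) (h₂ : ‖w₂‖ = n) :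
    ⟪w₁ - w₂, w₂⟫ = -(‖w₁ - w₂‖ ^ 2 / 2) := by
  rw [norm_sub_sq_real, inner_sub_left, real_inner_self_eq_norm_sq, h₁, h₂]
  ring

/-- At `w₂` the chord to `w₁` points into the ball while `w₂ - v` points outward and is close to the
normal: their normal components are opposite. -/
lemma angle_outer {m n : ℝ} (h : m < n) (hmn : 4 * m ^ 2 ≤ 3 * n ^ 2) {v w₁ w₂ : H}
    (hv : ‖v‖ ≤ m) (h₁ : ‖w₁‖ = n) (h₂ : ‖w₂‖ = n) :
    0 < ⟪(w₁ - v) - (w₂ - v), w₂ - v⟫ →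
      4 * ⟪(w₁ - v) - (w₂ - v), w₂ - v⟫ ^ 2 ≤
        3 * (‖(w₁ - v) - (w₂ - v)‖ ^ 2 * ‖w₂ - v‖ ^ 2) := by
  intro hX
  rw [sub_sub_sub_cancel_right] at *
  refine sq_inner_le_of_opposite ((norm_nonneg v).trans_lt (hv.trans_lt h)) h₂
    (sq_inner_sub_ge hmn hv h₂) ?_ hX.le
  rw [inner_chord h₁ h₂]
  have := inner_sub_pos h hv h₂
  have := mul_nonneg this.le (sq_nonneg ‖w₁ - w₂‖)
  linarith

/-- The rays from the outer point `v` enter the ball of radius `n` at `w₁` and `w₂`, the first of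
them at an angle at most `π / 3` with the normal. -/
lemma angle_inner {n : ℝ} (hn : 0 < n) {v w₁ w₂ : H} (h₁ : ‖w₁‖ = n) (h₂ : ‖w₂‖ = n)
    (hK : n ^ 2 * ‖w₁ - v‖ ^ 2 ≤ 4 * ⟪w₁ - v, w₁⟫ ^ 2) (hneg : ⟪w₁ - v, w₁⟫ ≤ 0) :
    0 < ⟪(w₁ - v) - (w₂ - v), w₂ - v⟫ →
      4 * ⟪(w₁ - v) - (w₂ - v), w₂ - v⟫ ^ 2 ≤
        3 * (‖(w₁ - v) - (w₂ - v)‖ ^ 2 * ‖w₂ - v‖ ^ 2) := by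
  intro hX
  rw [sub_sub_sub_cancel_right] at *
  have hc : ⟪w₁ - w₂, w₁⟫ = ‖w₁ - w₂‖ ^ 2 / 2 := by
    have := inner_chord h₂ h₁
    rw [← neg_sub w₁ w₂, inner_neg_left, norm_neg] at this
    linarith
  have e : w₁ - v = (w₂ - v) + (w₁ - w₂) := by abel
  -- Since `w₁ - v` is `w₂ - v` tilted towards the chord `w₁ - w₂`, a lower bound for its angle with
  -- the chord passes to `w₂ - v`.
  have e1 : ⟪w₁ - w₂, w₁ - v⟫ = ⟪w₁ - w₂, w₂ - v⟫ + ‖w₁ - w₂‖ ^ 2 := by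
    rw [e, inner_add_right, real_inner_self_eq_norm_sq]
  have e2 : ‖w₁ - v‖ ^ 2 = ‖w₂ - v‖ ^ 2 + 2 * ⟪w₁ - w₂, w₂ - v⟫ + ‖w₁ - w₂‖ ^ 2 := by
    rw [e, norm_add_sq_real, real_inner_comm]
  have key := sq_inner_le_of_opposite (c := w₁ - w₂) hn h₁ hK (by
    rw [hc]
    have := mul_nonneg (neg_nonneg.2 hneg) (sq_nonneg ‖w₁ - w₂‖)
    linarith) (by rw [e1]; positivity)
  rw [e1, e2] at key
  nlinarith [sq_nonneg (‖w₁ - w₂‖ ^ 2), mul_nonneg hX.le (sq_nonneg ‖w₁ - w₂‖)]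

lemma exists_smul_of_mem_segment {v v₁ w : H} (hw : w ∈ segment ℝ v v₁) (hne : w ≠ v) :
    ∃ s : ℝ, 1 ≤ s ∧ v₁ - v = s • (w - v) := by
  rw [segment_eq_image'] at hw
  obtain ⟨t, ⟨ht0, ht1⟩, rfl⟩ := hw
  have ht : t ≠ 0 := by rintro rfl; simp at hne
  have htp : 0 < t := lt_of_le_of_ne ht0 ht.symm
  refine ⟨t⁻¹, (one_le_inv₀ htp).2 ht1, ?_⟩
  simp [smul_smul, inv_mul_cancel₀ ht]

/-- Projection to the sphere along rays from a small ball is 2-Lipschitz outside the sphere. -/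
lemma outer_lipschitz {m n : ℝ} (h : m < n) (hmn : 4 * m ^ 2 ≤ 3 * n ^ 2) {v v₁ v₂ w₁ w₂ : H}
    (hv : ‖v‖ ≤ m) (hw₁ : w₁ ∈ segment ℝ v v₁) (hw₂ : w₂ ∈ segment ℝ v v₂)
    (h₁ : ‖w₁‖ = n) (h₂ : ‖w₂‖ = n) : ‖w₁ - w₂‖ ≤ 2 * ‖v₁ - v₂‖ := by
  have hne : ∀ w : H, ‖w‖ = n → w ≠ v := by rintro w hw rfl; linarith
  obtain ⟨s₁, hs₁, e₁⟩ := exists_smul_of_mem_segment hw₁ (hne _ h₁)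
  obtain ⟨s₂, hs₂, e₂⟩ := exists_smul_of_mem_segment hw₂ (hne _ h₂)
  have := norm_sub_le_two_mul hs₁ hs₂ (angle_outer h hmn hv h₁ h₂) (angle_outer h hmn hv h₂ h₁)
  rwa [← e₁, ← e₂, sub_sub_sub_cancel_right, sub_sub_sub_cancel_right] at this

/-- Projection to the sphere along rays from an outer point is 2-Lipschitz on a small ball. -/
lemma inner_lipschitz {m n : ℝ} (h : m < n) (hmn : 4 * m ^ 2 ≤ 3 * n ^ 2) {v v₁ v₂ w₁ w₂ : H}
    (hv : n ≤ ‖v‖) (hv₁ : ‖v₁‖ ≤ m) (hv₂ : ‖v₂‖ ≤ m)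
    (hw₁ : w₁ ∈ segment ℝ v v₁) (hw₂ : w₂ ∈ segment ℝ v v₂)
    (h₁ : ‖w₁‖ = n) (h₂ : ‖w₂‖ = n) : ‖w₁ - w₂‖ ≤ 2 * ‖v₁ - v₂‖ := by
  have hn : 0 < n := (norm_nonneg v₁).trans_lt (hv₁.trans_lt h)
  -- At `w` the vectors from `v` and from `v₁` are opposite, so the angle bound for the small ball
  -- transfers with a change of sign.
  have key : ∀ {v₁ w : H}, ‖v₁‖ ≤ m → w ∈ segment ℝ v v₁ → ‖w‖ = n →
      n ^ 2 * ‖w - v‖ ^ 2 ≤ 4 * ⟪w - v, w⟫ ^ 2 ∧ ⟪w - v, w⟫ ≤ 0 := by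
    intro v₁ w hv₁ hw hwn
    have hne : w ≠ v₁ := by rintro rfl; linarith
    rw [segment_symm] at hw
    obtain ⟨s, hs, e⟩ := exists_smul_of_mem_segment hw hne
    have e' : w - v = -(s - 1) • (w - v₁) := by
      have : w - v = (w - v₁) - (v - v₁) := by abel
      rw [this, e, neg_smul, sub_smul, one_smul]
      abel
    have k1 := sq_inner_sub_ge hmn hv₁ hwn
    have k2 := inner_sub_pos h hv₁ hwn
    rw [e', norm_smul, inner_smul_left, mul_pow, mul_pow, Real.norm_eq_abs, sq_abs]
    simp only [conj_trivial]
    constructor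
    · nlinarith [sq_nonneg (-(s - 1))]
    · nlinarith
  have main : ∀ {v₁ v₂ w₁ w₂ : H}, ‖v₁‖ ≤ m → ‖v₂‖ ≤ m → w₁ ∈ segment ℝ v v₁ →
      w₂ ∈ segment ℝ v v₂ → ‖w₁‖ = n → ‖w₂‖ = n → w₁ ≠ v → w₂ ≠ v →
      ‖w₁ - w₂‖ ≤ 2 * ‖v₁ - v₂‖ := by
    intro v₁ v₂ w₁ w₂ hv₁ hv₂ hw₁ hw₂ h₁ h₂ n₁ n₂
    obtain ⟨s₁, hs₁, e₁⟩ := exists_smul_of_mem_segment hw₁ n₁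
    obtain ⟨s₂, hs₂, e₂⟩ := exists_smul_of_mem_segment hw₂ n₂
    obtain ⟨k₁, l₁⟩ := key hv₁ hw₁ h₁
    obtain ⟨k₂, l₂⟩ := key hv₂ hw₂ h₂
    have := norm_sub_le_two_mul hs₁ hs₂ (angle_inner hn h₁ h₂ k₁ l₁) (angle_inner hn h₂ h₁ k₂ l₂)
    rwa [← e₁, ← e₂, sub_sub_sub_cancel_right, sub_sub_sub_cancel_right] at this
  -- A second crossing `w` would end a chord from `v`, which leaves the ball at `w`, against the
  -- sign in `key`.
  have stay : ∀ {v₁ w : H}, ‖v₁‖ ≤ m → w ∈ segment ℝ v v₁ → ‖w‖ = n → ‖v‖ = n → w = v := by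
    intro v₁ w hv₁ hw hwn hvn
    by_contra hne
    obtain ⟨s, hs, e⟩ := exists_smul_of_mem_segment hw hne
    obtain ⟨-, l⟩ := key hv₁ hw hwn
    have c := inner_chord hvn hwn
    have : ⟪w - v, w⟫ = ‖v - w‖ ^ 2 / 2 := by
      rw [← neg_sub v w, inner_neg_left, c, neg_neg]
    have : 0 < ‖v - w‖ := norm_pos_iff.2 (sub_ne_zero.2 (Ne.symm hne))
    nlinarith
  rcases hv.eq_or_lt with hv | hv
  · rw [stay hv₁ hw₁ h₁ hv.symm, stay hv₂ hw₂ h₂ hv.symm]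
    simp
  · exact main hv₁ hv₂ hw₁ hw₂ h₁ h₂ (by rintro rfl; linarith) (by rintro rfl; linarith)

/-- Sufficient condition for the geometric conditions in the definition of `ortH`. -/
lemma ortCondition_of_le {m n : ℕ} (h : m < n) (hmn : 4 * (m : ℝ) ^ 2 ≤ 3 * (n : ℝ) ^ 2) :
    OrtCondition H m n := by
  have h' : (m : ℝ) < n := by exact_mod_cast h
  refine ⟨h, ?_, ?_, ?_⟩
  · intro ε _ _ v v₁ v₂ _ hv hd w₁ hw₁ w₂ hw₂ h₁ h₂
    linarith [outer_lipschitz h' hmn hv hw₁ hw₂ h₁ h₂]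
  · intro ε _ _ v v₁ v₂ hm hv hd w₁ hw₁ w₂ hw₂ h₁ h₂
    linarith [inner_lipschitz h' hmn hv.le ((le_max_left _ _).trans hm)
      ((le_max_right _ _).trans hm) hw₁ hw₂ h₁ h₂]
  · intro ε hε _ v v₁ v₂ _ hv₂ hv hmem hv₁
    have hne : v ≠ v₂ := by rintro rfl; linarith
    rw [segment_symm] at hmem
    obtain ⟨s, hs, e⟩ := exists_smul_of_mem_segment hmem hne
    set d := v₁ - v with hd
    have ed : d = (s - 1) • (v - v₂) := by
      have : d = (v₁ - v₂) - (v - v₂) := by rw [hd]; abel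
      rw [this, e, sub_smul, one_smul]
    have k := half_norm_le_inner_sub h' hmn hv₂ hv
    have k' : n * ‖d‖ ≤ 2 * ⟪d, v⟫ := by
      rw [ed, norm_smul, inner_smul_left, Real.norm_eq_abs, abs_of_nonneg (by linarith)]
      simp only [conj_trivial]
      nlinarith
    have e1 : v₁ = d + v := by rw [hd]; abel
    have e2 : ‖v₁‖ ^ 2 = ‖d‖ ^ 2 + 2 * ⟪d, v⟫ + n ^ 2 := by rw [e1, norm_add_sq_real, hv]
    have e3 : ‖v₁‖ ^ 2 ≤ (n + ε) ^ 2 := by gcongr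
    -- Here `‖v₁‖ ^ 2 ≥ n ^ 2 + n * ‖d‖ + ‖d‖ ^ 2`, which exceeds `(n + ε) ^ 2` once `‖d‖ > 2 * ε`.
    by_contra hc
    push Not at hc
    have hn : (0 : ℝ) ≤ n := by positivity
    nlinarith [mul_le_mul_of_nonneg_left hc.le hn]

/-- Necessity of the bound, by orthogonal vectors. -/
lemma OrtCondition.le {m n : ℕ} (h : OrtCondition H m n) {e f : H} (he : ‖e‖ = 1) (hf : ‖f‖ = 1)
    (hef : ⟪e, f⟫ = 0) : 4 * (m : ℝ) ^ 2 ≤ 3 * (n : ℝ) ^ 2 := by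
  by_contra hc
  push Not at hc
  have hmn : (m : ℝ) < n := by exact_mod_cast h.lt
  have hm : (0 : ℝ) ≤ m := by positivity
  -- The counterexample to `cross` moves from `m • e` along `f`, meeting the sphere at `m • e + k •
  -- f`. The cosine with the normal is `k / n < 1 / 2` there, so a further step slightly above `2 *
  -- ε` raises the norm by at most `ε`.
  set k := Real.sqrt (n ^ 2 - m ^ 2) with hk
  have hk2 : k ^ 2 = n ^ 2 - m ^ 2 := Real.sq_sqrt (by nlinarith)
  have hk0 : 0 ≤ k := Real.sqrt_nonneg _
  have hkn : 2 * k < n := by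
    refine lt_of_pow_lt_pow_left₀ 2 (by linarith) ?_
    nlinarith
  have nrm : ∀ t : ℝ, ‖(m : ℝ) • e + t • f‖ ^ 2 = m ^ 2 + t ^ 2 := by
    intro t
    rw [norm_add_sq_real, norm_smul, norm_smul, inner_smul_left, inner_smul_right, he, hf, hef]
    simp
  set δ := n - 2 * k with hδ
  have hδ0 : 0 < δ := by linarith
  have hn0 : (0 : ℝ) < n := by linarith
  -- a step slightly longer than `2 * ε`
  obtain ⟨η, hη0, hη1, hη2⟩ : ∃ η : ℝ, 0 < η ∧ η ≤ 1 ∧ k * η ≤ δ / 2 := by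
    refine ⟨min 1 (δ / (2 * n)), by positivity, min_le_left _ _, ?_⟩
    calc k * min 1 (δ / (2 * n)) ≤ n * (δ / (2 * n)) := by
          gcongr
          · linarith
          · exact min_le_right _ _
      _ = δ / 2 := by field_simp
  obtain ⟨ε, hε0, hε1, hε2⟩ : ∃ ε : ℝ, 0 < ε ∧ ε < 1 / 2 ∧ 9 * ε ≤ δ :=
    ⟨min (1 / 4) (δ / 9), by positivity, (min_le_left _ _).trans_lt (by norm_num),
      by linarith [min_le_right (1 / 4 : ℝ) (δ / 9)]⟩
  set t := (2 + η) * ε with ht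
  have ht0 : 0 < t := by positivity
  have hv : ‖(m : ℝ) • e + k • f‖ = n := by
    refine (sq_eq_sq₀ (norm_nonneg _) hn0.le).1 ?_
    rw [nrm, hk2]; ring
  have hv₂ : ‖(m : ℝ) • e‖ = m := by rw [norm_smul, he]; simp
  have hkp : 0 < k + t := by positivity
  have hv₁ : (n : ℝ) ≤ ‖(m : ℝ) • e + (k + t) • f‖ := by
    refine le_of_sq_le_sq ?_ (norm_nonneg _)
    rw [nrm]; nlinarith
  have hv₁' : ‖(m : ℝ) • e + (k + t) • f‖ ≤ n + ε := by
    refine le_of_sq_le_sq ?_ (by positivity)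
    rw [nrm]
    have a1 : t ^ 2 ≤ 9 * ε * ε := by
      have : t ≤ 3 * ε := by rw [ht]; nlinarith
      nlinarith
    have a2 : 2 * k * t ≤ (2 * n - δ) * ε := by
      rw [ht]
      have : 2 * k * (2 + η) ≤ 2 * n - δ := by nlinarith
      nlinarith
    nlinarith
  have hmem : (m : ℝ) • e + k • f ∈ segment ℝ ((m : ℝ) • e + (k + t) • f) ((m : ℝ) • e) := by
    rw [segment_symm, segment_eq_image']
    refine ⟨k / (k + t), ⟨by positivity, ?_⟩, ?_⟩
    · rw [div_le_one hkp]; linarith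
    · have : k / (k + t) * (k + t) = k := by field_simp
      simp [smul_smul, this]
  have := h.cross ε hε0 hε1 _ _ _ hv₁ hv₂.le hv hmem hv₁'
  have e1 : (m : ℝ) • e + (k + t) • f - ((m : ℝ) • e + k • f) = t • f := by
    rw [add_smul]; abel
  rw [e1, norm_smul, hf, Real.norm_eq_abs, abs_of_pos ht0, mul_one] at this
  nlinarith [mul_pos hη0 hε0]

end Geometry

/-! ### The number `ortH m`. -/

lemma ortCondition_ortH (m : ℕ) : OrtCondition (lp (fun _ : ℕ => ℝ) 2) m (ortH m) := by
  -- A member such as `2 * m + 1` must be exhibited, because the infimum of an empty set of naturals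
  -- is the default 0.
  refine Nat.sInf_mem (s := {n : ℕ | OrtCondition (lp (fun _ : ℕ => ℝ) 2) m n})
    ⟨2 * m + 1, ortCondition_of_le (by lia) ?_⟩
  push_cast
  nlinarith [(Nat.cast_nonneg m : (0 : ℝ) ≤ m)]

lemma lt_of_ortH_lt {m n : ℕ} (h : ortH m < n) : m < n := (ortCondition_ortH m).lt.trans h

lemma cast_lt_of_ortH_lt {m n : ℕ} (h : ortH m < n) : (m : ℝ) < n :=
  Nat.cast_lt.2 (lt_of_ortH_lt h)

/-- This and `m < n` are all the geometry of `ortH` that is used below. -/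
lemma four_mul_sq_le_of_ortH_lt {m n : ℕ} (h : ortH m < n) :
    4 * (m : ℝ) ^ 2 ≤ 3 * (n : ℝ) ^ 2 := by
  have h1 : 4 * (m : ℝ) ^ 2 ≤ 3 * (ortH m : ℝ) ^ 2 := by
    refine (ortCondition_ortH m).le (e := lp.single 2 0 (1 : ℝ)) (f := lp.single 2 1 (1 : ℝ))
      ?_ ?_ ?_
    · simp [lp.norm_single]
    · simp [lp.norm_single]
    · simp [lp.inner_single_left]
  have h2 : (ortH m : ℝ) ^ 2 ≤ (n : ℝ) ^ 2 := by gcongr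
  linarith

/-! ### The visible length of a segment. -/

section Length

variable {H : Type v} [NormedAddCommGroup H] [InnerProductSpace ℝ H]

lemma diam_segment_eq (a b : H) : Metric.diam (segment ℝ a b) = dist a b := by
  rw [← convexHull_pair, convexHull_diam, Metric.diam_pair]

lemma segment_subset_closedBall {r : ℝ} {a b : H} (ha : ‖a‖ ≤ r) (hb : ‖b‖ ≤ r) :
    segment ℝ a b ⊆ Metric.closedBall (0 : H) r :=
  (convex_closedBall (0 : H) r).segment_subset (mem_closedBall_zero_iff.2 ha)
    (mem_closedBall_zero_iff.2 hb)

lemma lengthInBall_of_norm_le {n : ℕ} {a y : H} (ha : ‖a‖ ≤ n) (hy : ‖y‖ ≤ n) :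
    lengthInBall n a y = dist a y := by
  rw [lengthInBall, Set.inter_eq_left.2 (segment_subset_closedBall ha hy), diam_segment_eq]

lemma lengthInBall_of_exit {n : ℕ} {a y w : H} (hy : ‖y‖ < n) (hw : w ∈ segment ℝ a y)
    (hwn : ‖w‖ = n) : lengthInBall n a y = dist w y := by
  have : segment ℝ a y ∩ Metric.closedBall (0 : H) (n : ℝ) = segment ℝ w y := by
    refine Set.Subset.antisymm ?_ (Set.subset_inter ?_ ?_)
    · rintro p ⟨hp, hpn⟩
      rw [mem_closedBall_zero_iff] at hpn
      rw [segment_symm, segment_eq_image'] at hp hw ⊢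
      obtain ⟨t, ⟨ht0, ht1⟩, rfl⟩ := hw
      obtain ⟨s, ⟨hs0, hs1⟩, rfl⟩ := hp
      have htp : 0 < t := by
        refine lt_of_le_of_ne ht0 ?_
        rintro rfl
        simp at hwn
        linarith
      have hst : s ≤ t := by
        -- Otherwise the exit point is a proper convex combination of `y`, of norm below `n`, and a
        -- point of norm at most `n`.
        by_contra hlt
        push Not at hlt
        have hsp : 0 < s := htp.trans hlt
        have e : y + t • (a - y) = (1 - t / s) • y + (t / s) • (y + s • (a - y)) := by
          have : t / s * s = t := by field_simp
          rw [smul_add, smul_smul, this, sub_smul, one_smul]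
          abel
        have h1 : t / s < 1 := (div_lt_one hsp).2 hlt
        have h0 : 0 < t / s := by positivity
        have := norm_add_le ((1 - t / s) • y) ((t / s) • (y + s • (a - y)))
        rw [← e, hwn, norm_smul, norm_smul, Real.norm_eq_abs, Real.norm_eq_abs,
          abs_of_pos (by linarith), abs_of_pos h0] at this
        nlinarith
      refine ⟨s / t, ⟨by positivity, (div_le_one htp).2 hst⟩, ?_⟩
      have : s / t * t = s := by field_simp
      simp [smul_smul, this]
    · exact (convex_segment a y).segment_subset hw (right_mem_segment ℝ a y)
    · exact segment_subset_closedBall hwn.le hy.le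
  rw [lengthInBall, this, diam_segment_eq]

lemma exists_mem_segment_norm_eq {r : ℝ} {a y : H} (hy : ‖y‖ ≤ r) (ha : r ≤ ‖a‖) :
    ∃ w ∈ segment ℝ a y, ‖w‖ = r :=
  (convex_segment a y).isPreconnected.intermediate_value (right_mem_segment ℝ a y)
    (left_mem_segment ℝ a y) continuous_norm.continuousOn ⟨hy, ha⟩

/-- The end point of the part of `[y, a]` inside of the ball. -/
lemma exists_lengthInBall_eq {n : ℕ} {y : H} (hy : ‖y‖ < n) (a : H) :
    ∃ w ∈ segment ℝ a y, ‖w‖ ≤ n ∧ lengthInBall n a y = dist w y ∧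
      (‖a‖ ≤ n → w = a) ∧ ((n : ℝ) ≤ ‖a‖ → ‖w‖ = n) := by
  rcases le_or_gt ‖a‖ n with ha | ha
  · exact ⟨a, left_mem_segment ℝ a y, ha, lengthInBall_of_norm_le ha hy.le, fun _ => rfl,
      fun h => le_antisymm ha h⟩
  · obtain ⟨w, hw, hwn⟩ := exists_mem_segment_norm_eq hy.le ha.le
    exact ⟨w, hw, hwn.le, lengthInBall_of_exit hy hw hwn, fun h => absurd h (not_le.2 ha),
      fun _ => hwn⟩

lemma lengthInBall_mem_Icc {m n : ℕ} (h : m < n) {y : H} (hy : ‖y‖ ≤ m) (a : H) :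
    lengthInBall n a y ∈ Set.Icc (0 : ℝ) (n + m) := by
  obtain ⟨w, -, hw, e, -⟩ := exists_lengthInBall_eq (hy.trans_lt (Nat.cast_lt.2 h)) a
  rw [e, dist_eq_norm]
  exact ⟨norm_nonneg _, (norm_sub_le w y).trans (add_le_add hw hy)⟩

/-- The length of the visible part detects that the end point is in the small ball. -/
lemma norm_lt_of_lengthInBall_lt {m n : ℕ} (h : m < n) {a : H}
    (ha : lengthInBall n a (0 : H) < m) : ‖a‖ < m := by
  have h' : (m : ℝ) < n := Nat.cast_lt.2 h
  have h0 : ‖(0 : H)‖ < n := by rw [norm_zero]; exact (Nat.cast_nonneg m).trans_lt h'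
  obtain ⟨w, -, -, e, e1, e2⟩ := exists_lengthInBall_eq h0 a
  rw [e, dist_zero_right] at ha
  rcases le_total ‖a‖ n with han | han
  · rwa [e1 han] at ha
  · linarith [e2 han]

/-- If `a` is outside, the exit point has norm `n ≥ m + 1`; this is where integrality of the radii
matters. -/
lemma one_le_lengthInBall {m n : ℕ} (h : m < n) {a y : H} (hy : ‖y‖ ≤ m) (ha : 1 ≤ dist a y) :
    1 ≤ lengthInBall n a y := by
  have h' : (m : ℝ) + 1 ≤ n := by exact_mod_cast h
  obtain ⟨w, -, -, e, e1, e2⟩ := exists_lengthInBall_eq (by linarith : ‖y‖ < n) a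
  rw [e]
  rcases le_total ‖a‖ n with han | han
  · rwa [e1 han]
  · rw [dist_eq_norm]
    linarith [e2 han, norm_sub_norm_le w y]

/-- Inside the ball the length is a distance; outside, the exit point is a 2-Lipschitz projection of
`a`. In the mixed case `[a, b]` is cut where it meets the sphere. -/
lemma lengthInBall_lipschitz_left {m n : ℕ} (h : m < n) (hmn : 4 * (m : ℝ) ^ 2 ≤ 3 * (n : ℝ) ^ 2)
    {y : H} (hy : ‖y‖ ≤ m) (a b : H) :
    |lengthInBall n a y - lengthInBall n b y| ≤ 2 * dist a b := by
  have h' : (m : ℝ) < n := Nat.cast_lt.2 h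
  have hyn := hy.trans_lt h'
  have hin : ∀ a b : H, ‖a‖ ≤ n → ‖b‖ ≤ n →
      |lengthInBall n a y - lengthInBall n b y| ≤ 2 * dist a b := by
    intro a b ha hb
    rw [lengthInBall_of_norm_le ha hyn.le, lengthInBall_of_norm_le hb hyn.le]
    linarith [abs_dist_sub_le a b y, dist_nonneg (x := a) (y := b)]
  have hout : ∀ a b : H, n ≤ ‖a‖ → n ≤ ‖b‖ →
      |lengthInBall n a y - lengthInBall n b y| ≤ 2 * dist a b := by
    intro a b ha hb
    obtain ⟨p, hp, -, e, -, hpn⟩ := exists_lengthInBall_eq hyn a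
    obtain ⟨q, hq, -, e', -, hqn⟩ := exists_lengthInBall_eq hyn b
    rw [e, e']
    rw [segment_symm] at hp hq
    have := outer_lipschitz h' hmn hy hp hq (hpn ha) (hqn hb)
    rw [← dist_eq_norm, ← dist_eq_norm] at this
    exact (abs_dist_sub_le p q y).trans this
  have hmix : ∀ a b : H, ‖a‖ ≤ n → n ≤ ‖b‖ →
      |lengthInBall n a y - lengthInBall n b y| ≤ 2 * dist a b := by
    intro a b ha hb
    obtain ⟨p, hp, hpn⟩ := exists_mem_segment_norm_eq ha hb
    have h1 := hin a p ha hpn.le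
    have h2 := hout p b hpn.ge hb
    rw [segment_symm] at hp
    have h3 := dist_add_dist_of_mem_segment hp
    have := abs_sub_le (lengthInBall n a y) (lengthInBall n p y) (lengthInBall n b y)
    linarith
  rcases le_total ‖a‖ n with ha | ha <;> rcases le_total ‖b‖ n with hb | hb
  · exact hin a b ha hb
  · exact hmix a b ha hb
  · rw [abs_sub_comm, dist_comm]
    exact hmix b a hb ha
  · exact hout a b ha hb

/-- The constant is 2 for the motion of the exit point plus 1 for that of the other end. -/
lemma lengthInBall_lipschitz_right {m n : ℕ} (h : m < n) (hmn : 4 * (m : ℝ) ^ 2 ≤ 3 * (n : ℝ) ^ 2)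
    (a : H) {x y : H} (hx : ‖x‖ ≤ m) (hy : ‖y‖ ≤ m) :
    |lengthInBall n a x - lengthInBall n a y| ≤ 3 * dist x y := by
  have h' : (m : ℝ) < n := Nat.cast_lt.2 h
  obtain ⟨p, hp, -, e, hpa, hpn⟩ := exists_lengthInBall_eq (hx.trans_lt h') a
  obtain ⟨q, hq, -, e', hqa, hqn⟩ := exists_lengthInBall_eq (hy.trans_lt h') a
  have key : dist p q ≤ 2 * dist x y := by
    rcases le_total ‖a‖ n with ha | ha
    · rw [hpa ha, hqa ha, dist_self]; positivity
    · rw [dist_eq_norm, dist_eq_norm]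
      exact inner_lipschitz h' hmn ha hx hy hp hq (hpn ha) (hqn ha)
  rw [e, e']
  have h1 := abs_dist_sub_le p q x
  have h2 := abs_dist_sub_le x y q
  rw [dist_comm x q, dist_comm y q] at h2
  have := abs_sub_le (dist p x) (dist q x) (dist q y)
  linarith

end Length

/-! ### Connectives and quantifiers of continuous logic. -/

lemma tsub_nonneg (a b : ℝ) : 0 ≤ a ∸ b := le_max_right _ _

lemma tsub_eq_zero {a b : ℝ} (h : a ≤ b) : a ∸ b = 0 := max_eq_right (by linarith)

lemma lt_of_tsub_pos {a b : ℝ} (h : 0 < a ∸ b) : b < a := by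
  by_contra hc
  exact h.ne' (tsub_eq_zero (not_lt.1 hc))

/-- A guarded axiom is the minimum of a defect `a` and a guard `b`: where the guard is positive, the
defect has to vanish. -/
lemma min_eq_zero_of_imp {a b : ℝ} (ha : 0 ≤ a) (hb : 0 ≤ b) (h : 0 < b → a = 0) :
    min a b = 0 := by
  rcases hb.eq_or_lt with hb | hb
  · rw [← hb, min_eq_right ha]
  · rw [h hb, min_eq_left hb.le]

/-- The suprema in the axioms are killed term by term, so the default value of an unbounded real
supremum never interferes. -/
lemma iSup_eq_zero_of_forall {ι : Sort*} {f : ι → ℝ} (h : ∀ i, f i = 0) : ⨆ i, f i = 0 := by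
  simp [h]

lemma iInf_eq_zero_of_nonneg {ι : Sort*} {f : ι → ℝ} (h : ∀ i, 0 ≤ f i) (i : ι) (hi : f i = 0) :
    ⨅ i, f i = 0 :=
  le_antisymm (hi ▸ ciInf_le ⟨0, by rintro _ ⟨j, rfl⟩; exact h j⟩ i) (Real.iInf_nonneg h)

/-! ### Metric groups as topological groups. -/

section Group

variable {G : Type u} [Group G] [MetricSpace G]

lemma IsMetricGroup.dist_one (hG : IsMetricGroup G) (g h : G) : dist 1 (g⁻¹ * h) = dist g h := by
  have := hG.dist_mul_left g 1 (g⁻¹ * h)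
  rw [← this, mul_one, mul_inv_cancel_left]

lemma IsMetricGroup.isTopologicalGroup (hG : IsMetricGroup G) : IsTopologicalGroup G where
  continuous_mul := by
    refine LipschitzWith.continuous (K := 2) (LipschitzWith.of_dist_le_mul ?_)
    rintro ⟨a, b⟩ ⟨c, d⟩
    have h1 := dist_triangle (a * b) (c * b) (c * d)
    rw [hG.dist_mul_right, hG.dist_mul_left] at h1
    have h2 := le_max_left (dist a c) (dist b d)
    have h3 := le_max_right (dist a c) (dist b d)
    simp only [Prod.dist_eq, NNReal.coe_ofNat]
    linarith
  continuous_inv := by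
    refine Isometry.continuous (Isometry.of_dist_eq fun a b => ?_)
    rw [← hG.dist_mul_left a, ← hG.dist_mul_right b, mul_inv_cancel, one_mul, inv_mul_cancel_right,
      dist_comm]

end Group

/-! ### Axioms of the class for the structure of an action. -/

section Action

variable {G : Type u} [Group G] [MetricSpace G]
  {H : Type v} [NormedAddCommGroup H] [InnerProductSpace ℝ H] {ρ : G →* (H ≃ᵃⁱ[ℝ] H)}

lemma map_mul_apply (ρ : G →* (H ≃ᵃⁱ[ℝ] H)) (g h : G) (x : H) : ρ (g * h) x = ρ g (ρ h x) := by
  rw [map_mul]; rfl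

lemma map_one_apply (ρ : G →* (H ≃ᵃⁱ[ℝ] H)) (x : H) : ρ 1 x = x := by
  rw [map_one]; rfl

lemma map_inv_apply_self (ρ : G →* (H ≃ᵃⁱ[ℝ] H)) (g : G) (x : H) : ρ g⁻¹ (ρ g x) = x := by
  rw [← map_mul_apply, inv_mul_cancel, map_one_apply]

lemma map_apply_inv_self (ρ : G →* (H ≃ᵃⁱ[ℝ] H)) (g : G) (x : H) : ρ g (ρ g⁻¹ x) = x := by
  rw [← map_mul_apply, mul_inv_cancel, map_one_apply]

lemma Ball.norm_le {m : ℕ} (x : Ball H m) : ‖x.1‖ ≤ m := mem_closedBall_zero_iff.1 x.2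

/-- An action that witnesses uniform non-FH is uniformly continuous on bounded sets. -/
lemma WitnessesUniform.exists_modulus (hG : IsMetricGroup G) (hρ : WitnessesUniform ρ) (m : ℕ) :
    ∃ γ : ℝ → ℝ, IsModulus γ ∧ ∀ ε > 0, ∀ (g g' : G) (x : H), ‖x‖ ≤ m → dist g g' < γ ε →
      dist (ρ g x) (ρ g' x) < ε := by
  obtain ⟨gth, -, hgth⟩ := hρ.growth
  -- Left translation by `g⁻¹` replaces the pair by `1` and `g⁻¹ * g'`, which is within `1 / 2` of
  -- `1`. Both then map `B_m` into `B_N`, so the partial modulus applies.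
  set N := max (gth m (1 / 2)) (ortH m + 1) with hN
  have hmN : ortH m < N := lt_of_lt_of_le (Nat.lt_succ_self _) (le_max_right _ _)
  obtain ⟨γ, hγ, hp⟩ := hρ.moduli m N hmN
  refine ⟨fun ε => min (1 / 2) (γ ε), fun ε hε => lt_min (by norm_num) (hγ ε hε), ?_⟩
  intro ε hε g g' x hx hd
  have h1 : dist 1 (g⁻¹ * g') < min (1 / 2) (γ ε) := by rwa [hG.dist_one]
  have h2 : ‖ρ (g⁻¹ * g') x‖ ≤ N := by
    refine (hgth m (1 / 2) (by norm_num) (by norm_num) _ (h1.le.trans (min_le_left _ _)) x hx).trans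
      (Nat.cast_le.2 (le_max_left _ _))
  have h3 : ‖ρ 1 x‖ ≤ N := by
    rw [map_one_apply]
    exact hx.trans (cast_lt_of_ortH_lt hmN).le
  have := hp ε hε 1 (g⁻¹ * g') x hx h3 h2 (h1.trans_le (min_le_right _ _))
  rwa [map_one_apply, map_mul_apply, ← (ρ g).dist_map, map_apply_inv_self] at this

lemma circOf_eq_dist {m n : ℕ} (h : m < n) {g : G} {x : Ball H m} (hx : ‖ρ g x.1‖ ≤ n)
    (y : Ball H m) : circOf ρ m n g x y = dist (ρ g x.1) y.1 :=
  lengthInBall_of_norm_le hx (y.norm_le.trans (Nat.cast_le.2 h.le))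

lemma norm_lt_of_circOf_lt {m n : ℕ} (h : m < n) {g : G} {x : Ball H m}
    (hx : 0 < (m : ℝ) ∸ circOf ρ m n g x (Ball.zero m)) : ‖ρ g x.1‖ < m :=
  norm_lt_of_lengthInBall_lt h (lt_of_tsub_pos hx)

/-- The guard puts `g ∘ x` inside `B_m`, hence the whole segment inside `B_n`. -/
lemma circOf_eq_dist_of_pos {m n : ℕ} (h : m < n) {g : G} {x : Ball H m}
    (hx : 0 < (m : ℝ) ∸ circOf ρ m n g x (Ball.zero m)) (y : Ball H m) :
    circOf ρ m n g x y = dist (ρ g x.1) y.1 :=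
  circOf_eq_dist h ((norm_lt_of_circOf_lt h hx).le.trans (Nat.cast_le.2 h.le)) y

lemma axiomsOne_actionStructure {gth : ℕ → ℝ → ℕ} (hgth : CorrespondsTo ρ gth) :
    (actionStructure ρ).AxiomsOne gth ortH where
  a m n s δ h0 h1 hm hn hs := by
    refine iSup_eq_zero_of_forall fun (g : G) => iSup_eq_zero_of_forall fun (x : Ball H m) => ?_
    refine min_eq_zero_of_imp (tsub_nonneg _ _) (tsub_nonneg _ _) fun h => tsub_eq_zero ?_
    have hx : ‖ρ g x.1‖ ≤ gth m δ := hgth m δ (by exact_mod_cast h0) (by exact_mod_cast h1) g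
      (lt_of_tsub_pos h).le x.1 x.norm_le
    have hx' : ‖ρ g x.1‖ ≤ n := hx.trans (Nat.cast_le.2 hn)
    change circOf ρ m s g x (Ball.zero m) ≤ n
    rw [circOf_eq_dist (lt_of_ortH_lt hm) (hx'.trans (Nat.cast_le.2 hs.le))]
    change dist _ (0 : H) ≤ _
    rwa [dist_zero_right]
  b m m' s t δ hmm h0 h1 hm hm' hs hst ht := by
    refine iSup_eq_zero_of_forall fun (g : G) => iSup_eq_zero_of_forall fun (x : Ball H m) =>
      iSup_eq_zero_of_forall fun (y : Ball H m) => ?_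
    refine min_eq_zero_of_imp (abs_nonneg _) (tsub_nonneg _ _) fun h => ?_
    have hx : ‖ρ g x.1‖ ≤ gth m δ := hgth m δ (by exact_mod_cast h0) (by exact_mod_cast h1) g
      (lt_of_tsub_pos h).le x.1 x.norm_le
    have hx' : ‖ρ g x.1‖ ≤ s := hx.trans (Nat.cast_le.2 hs.le)
    change |circOf ρ m s g x y - circOf ρ m' t g (Ball.incl hmm.le x) (Ball.incl hmm.le y)| = 0
    rw [circOf_eq_dist (lt_of_ortH_lt hm) hx', circOf_eq_dist (lt_of_ortH_lt hm')
      (hx'.trans (Nat.cast_le.2 hst.le) : ‖ρ g (Ball.incl hmm.le x).1‖ ≤ t)]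
    simp [Ball.incl]
  c m n hm := by
    have hmn := lt_of_ortH_lt hm
    refine iSup_eq_zero_of_forall fun (g : G) => iSup_eq_zero_of_forall fun (x : Ball H m) => ?_
    have hpos : ∀ z : Ball H m, 0 ≤ max (circOf ρ m n g x z)
          (⨆ w : Ball H m, min |dist w z - circOf ρ m n g x w|
            ((m : ℝ) ∸ dist (Ball.zero m) w)) := fun z =>
      le_max_of_le_right (Real.iSup_nonneg fun w => le_min (abs_nonneg _) (tsub_nonneg _ _))
    rw [min_comm]
    refine min_eq_zero_of_imp (Real.iInf_nonneg hpos) (tsub_nonneg _ _) fun h => ?_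
    change 0 < (m : ℝ) ∸ circOf ρ m n g x (Ball.zero m) at h
    have hx := norm_lt_of_circOf_lt hmn h
    obtain ⟨z, hz⟩ : ∃ z : Ball H m, z.1 = ρ g x.1 :=
      ⟨⟨ρ g x.1, mem_closedBall_zero_iff.2 hx.le⟩, rfl⟩
    refine iInf_eq_zero_of_nonneg hpos z ?_
    change max (circOf ρ m n g x z) _ = 0
    rw [iSup_eq_zero_of_forall, circOf_eq_dist_of_pos hmn h, hz]
    · simp
    · intro (w : Ball H m)
      change min |dist w z - circOf ρ m n g x w| ((m : ℝ) ∸ dist (Ball.zero m) w) = 0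
      rw [circOf_eq_dist_of_pos hmn h, Subtype.dist_eq, hz, dist_comm, sub_self, abs_zero]
      exact min_eq_left (tsub_nonneg _ _)

lemma axiomsTwo_actionStructure : (actionStructure ρ).AxiomsTwo ortH where
  a₁ m n hm := by
    refine iSup_eq_zero_of_forall fun (g : G) => iSup_eq_zero_of_forall fun (x : Ball H m) =>
      iSup_eq_zero_of_forall fun (y₁ : Ball H m) => iSup_eq_zero_of_forall fun (y₂ : Ball H m) => ?_
    refine min_eq_zero_of_imp (tsub_nonneg _ _) (tsub_nonneg _ _) fun h => tsub_eq_zero ?_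
    have e := circOf_eq_dist_of_pos (ρ := ρ) (lt_of_ortH_lt hm) h
    change dist y₁.1 y₂.1 ≤ circOf ρ m n g x y₁ + circOf ρ m n g x y₂
    rw [e, e]
    exact dist_triangle_left _ _ _
  a₂ m n hm := by
    refine iSup_eq_zero_of_forall fun (g : G) => iSup_eq_zero_of_forall fun (x : Ball H m) =>
      iSup_eq_zero_of_forall fun (y₁ : Ball H m) => iSup_eq_zero_of_forall fun (y₂ : Ball H m) => ?_
    refine min_eq_zero_of_imp (tsub_nonneg _ _) (tsub_nonneg _ _) fun h => tsub_eq_zero ?_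
    have e := circOf_eq_dist_of_pos (ρ := ρ) (lt_of_ortH_lt hm) h
    change circOf ρ m n g x y₁ ≤ dist y₁.1 y₂.1 + circOf ρ m n g x y₂
    rw [e, e, add_comm, dist_comm y₁.1]
    exact dist_triangle _ _ _
  b m n hm := by
    refine iSup_eq_zero_of_forall fun (g : G) => iSup_eq_zero_of_forall fun (x₁ : Ball H m) =>
      iSup_eq_zero_of_forall fun (x₂ : Ball H m) => ?_
    refine min_eq_zero_of_imp (Real.iSup_nonneg fun y => tsub_nonneg _ _)
      (le_min (tsub_nonneg _ _) (tsub_nonneg _ _)) fun h =>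
      iSup_eq_zero_of_forall fun (y : Ball H m) => tsub_eq_zero ?_
    have e₁ := circOf_eq_dist_of_pos (ρ := ρ) (lt_of_ortH_lt hm) (lt_min_iff.1 h).1
    have e₂ := circOf_eq_dist_of_pos (ρ := ρ) (lt_of_ortH_lt hm) (lt_min_iff.1 h).2
    change dist x₁.1 x₂.1 ≤ circOf ρ m n g x₁ y + circOf ρ m n g x₂ y
    rw [e₁, e₂, ← (ρ g).dist_map]
    exact dist_triangle_right _ _ _
  c m n hm := by
    have hmn := lt_of_ortH_lt hm
    refine iSup_eq_zero_of_forall fun (g : G) => iSup_eq_zero_of_forall fun (x₁ : Ball H m) =>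
      iSup_eq_zero_of_forall fun (x₂ : Ball H m) => ?_
    refine min_eq_zero_of_imp (Real.iInf_nonneg fun y => tsub_nonneg _ _)
      (le_min (tsub_nonneg _ _) (tsub_nonneg _ _)) fun h => ?_
    have e₁ := circOf_eq_dist_of_pos (ρ := ρ) hmn (lt_min_iff.1 h).1
    have e₂ := circOf_eq_dist_of_pos (ρ := ρ) hmn (lt_min_iff.1 h).2
    have hx := norm_lt_of_circOf_lt (ρ := ρ) hmn (lt_min_iff.1 h).1
    obtain ⟨z, hz⟩ : ∃ z : Ball H m, z.1 = ρ g x₁.1 :=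
      ⟨⟨ρ g x₁.1, mem_closedBall_zero_iff.2 hx.le⟩, rfl⟩
    refine iInf_eq_zero_of_nonneg (fun y => tsub_nonneg _ _) z (tsub_eq_zero ?_)
    change circOf ρ m n g x₁ z + circOf ρ m n g x₂ z ≤ dist x₁.1 x₂.1
    rw [e₁, e₂, hz, dist_self, zero_add, dist_comm]
    exact ((ρ g).dist_map _ _).le

lemma axiomsThree_actionStructure : (actionStructure ρ).AxiomsThree ortH where
  a m n hm := by
    refine iSup_eq_zero_of_forall fun (x : Ball H m) => iSup_eq_zero_of_forall fun (y : Ball H m) => ?_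
    change |circOf ρ m n 1 x y - dist x.1 y.1| = 0
    rw [circOf_eq_dist (lt_of_ortH_lt hm), map_one_apply, sub_self, abs_zero]
    rw [map_one_apply]
    exact x.norm_le.trans (cast_lt_of_ortH_lt hm).le
  b m n hm := by
    have hmn := lt_of_ortH_lt hm
    refine iSup_eq_zero_of_forall fun (g : G) => iSup_eq_zero_of_forall fun (x : Ball H m) =>
      iSup_eq_zero_of_forall fun (y : Ball H m) => ?_
    refine min_eq_zero_of_imp (abs_nonneg _) (le_min (tsub_nonneg _ _) (tsub_nonneg _ _))
      fun h => ?_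
    have e₁ := circOf_eq_dist_of_pos (ρ := ρ) hmn (lt_min_iff.1 h).1
    have e₂ := circOf_eq_dist_of_pos (ρ := ρ) (g := g⁻¹) hmn (lt_min_iff.1 h).2
    change |circOf ρ m n g x y - circOf ρ m n g⁻¹ y x| = 0
    rw [e₁, e₂, ← (ρ g).dist_map (ρ g⁻¹ y.1), map_apply_inv_self, dist_comm, sub_self, abs_zero]
  c m n hm := by
    have hmn := lt_of_ortH_lt hm
    refine iSup_eq_zero_of_forall fun (x : Ball H m) => iSup_eq_zero_of_forall fun (y : Ball H m) =>
      iSup_eq_zero_of_forall fun (g : G) => iSup_eq_zero_of_forall fun (g' : G) => ?_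
    refine min_eq_zero_of_imp (Real.iSup_nonneg fun y => tsub_nonneg _ _)
      (le_min (tsub_nonneg _ _) (le_min (tsub_nonneg _ _) (tsub_nonneg _ _))) fun h =>
      iSup_eq_zero_of_forall fun (z : Ball H m) => tsub_eq_zero ?_
    obtain ⟨h₁, h₂⟩ := lt_min_iff.1 h
    obtain ⟨h₂, h₃⟩ := lt_min_iff.1 h₂
    have e₁ := circOf_eq_dist_of_pos (ρ := ρ) (g := g⁻¹) hmn h₁
    have e₂ := circOf_eq_dist_of_pos (ρ := ρ) hmn h₂
    have e₃ := circOf_eq_dist_of_pos (ρ := ρ) (g := g * g') hmn h₃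
    change circOf ρ m n (g * g') x y ≤ circOf ρ m n g⁻¹ y z + circOf ρ m n g' x z
    rw [e₁, e₂, e₃, ← (ρ g⁻¹).dist_map, map_mul_apply, map_inv_apply_self, add_comm]
    exact dist_triangle_right _ _ _

/-- The structure of an action that witnesses uniform non-FH belongs to the class that is given by
its growth function and its moduli. -/
lemma WitnessesUniform.exists_inKisoH (hG : IsMetricGroup G) (hH : IsHilbert H)
    (hρ : WitnessesUniform ρ) :
    ∃ (gth : ℕ → ℝ → ℕ) (γ : ℕ → ℕ → ℝ → ℝ), IsGrowth gth ∧
      (actionStructure ρ).InKisoH gth ortH γ := by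
  obtain ⟨gth, hmono, hgth⟩ := hρ.growth
  choose γ hγ hp using fun m => hρ.exists_modulus hG m
  -- The argument is halved because the length is 2-Lipschitz in `g ∘ x`.
  refine ⟨gth, fun m _ ε => γ m (ε / 2), hmono, hG, hH, ?_, ?_, ?_, ?_, ?_,
    axiomsOne_actionStructure hgth, axiomsTwo_actionStructure, axiomsThree_actionStructure⟩
  · intro m n h (g : G) (x : Ball H m) (y : Ball H m)
    exact lengthInBall_mem_Icc (lt_of_ortH_lt h) y.norm_le _
  · intro m n h ε hε
    exact hγ m _ (half_pos hε)
  · intro m n h (x : Ball H m) (y : Ball H m) ε hε (g : G) (g' : G) hd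
    have h1 := lengthInBall_lipschitz_left (lt_of_ortH_lt h) (four_mul_sq_le_of_ortH_lt h)
      y.norm_le (ρ g x.1) (ρ g' x.1)
    have h2 := hp m _ (half_pos hε) g g' x.1 x.norm_le hd
    exact h1.trans_lt (by linarith)
  · intro m n h (g : G) (y : Ball H m) ε hε (x : Ball H m) (x' : Ball H m) hd
    have h1 := lengthInBall_lipschitz_left (lt_of_ortH_lt h) (four_mul_sq_le_of_ortH_lt h)
      y.norm_le (ρ g x.1) (ρ g x'.1)
    have h2 : dist x.1 x'.1 < ε / 3 := hd
    rw [(ρ g).dist_map] at h1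
    exact h1.trans_lt (by linarith [dist_nonneg (x := x.1) (y := x'.1)])
  · intro m n h (g : G) (x : Ball H m) ε hε (y : Ball H m) (y' : Ball H m) hd
    have h1 := lengthInBall_lipschitz_right (lt_of_ortH_lt h) (four_mul_sq_le_of_ortH_lt h)
      (ρ g x.1) y.norm_le y'.norm_le
    have h2 : dist y.1 y'.1 < ε / 3 := hd
    exact h1.trans_lt (by linarith)

/-! ### Fixed points -/

/-- An affine isometric action on a Hilbert space with a bounded orbit has a fixed point, namely
the centre of the smallest ball that contains the orbit. -/
lemma exists_fixedPoint_of_bounded [CompleteSpace H] (ρ : G →* (H ≃ᵃⁱ[ℝ] H)) {R : ℝ}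
    (hR : ∀ g, ‖ρ g 0‖ ≤ R) : ∃ x : H, ∀ g, ρ g x = x := by
  set F : H → ℝ := fun x => ⨆ g, ‖x - ρ g 0‖ ^ 2 with hF
  have hbdd : ∀ x, BddAbove (Set.range fun g => ‖x - ρ g 0‖ ^ 2) := by
    intro x
    refine ⟨(‖x‖ + R) ^ 2, ?_⟩
    rintro _ ⟨g, rfl⟩
    have := (norm_sub_le x (ρ g 0)).trans (by linarith [hR g] : _ ≤ ‖x‖ + R)
    dsimp only
    gcongr
  have hle : ∀ x g, ‖x - ρ g 0‖ ^ 2 ≤ F x := fun x g => le_ciSup (hbdd x) g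
  have hF0 : BddBelow (Set.range F) :=
    ⟨0, by rintro _ ⟨x, rfl⟩; exact Real.iSup_nonneg fun g => sq_nonneg _⟩
  set r := ⨅ x, F x with hr
  -- By the parallelogram law the midpoint of two almost optimal centres is better by a quarter of
  -- their squared distance. This gives both the Cauchy property and uniqueness of the centre.
  have hmid : ∀ (x y : H) (c : ℝ), (∀ g, ‖x - ρ g 0‖ ^ 2 ≤ c) → (∀ g, ‖y - ρ g 0‖ ^ 2 ≤ c) →
      ‖x - y‖ ^ 2 ≤ 4 * (c - r) := by
    intro x y c hx hy
    have h1 : r ≤ F ((1 / 2 : ℝ) • (x + y)) := ciInf_le hF0 _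
    have h2 : F ((1 / 2 : ℝ) • (x + y)) ≤ c - ‖x - y‖ ^ 2 / 4 := by
      refine ciSup_le fun g => ?_
      have e1 := parallelogram_law_with_norm ℝ (x - ρ g 0) (y - ρ g 0)
      have e2 : (1 / 2 : ℝ) • (x + y) - ρ g 0 = (1 / 2 : ℝ) • ((x - ρ g 0) + (y - ρ g 0)) := by
        module
      rw [sub_sub_sub_cancel_right] at e1
      rw [e2, norm_smul, mul_pow, Real.norm_eq_abs, abs_of_pos (by norm_num)]
      nlinarith [hx g, hy g]
    linarith
  have hseq : ∀ k : ℕ, ∃ x, F x < r + 1 / ((k : ℝ) + 1) := fun k =>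
    exists_lt_of_ciInf_lt (by rw [← hr]; linarith [Nat.one_div_pos_of_nat (α := ℝ) (n := k)])
  choose u hu using hseq
  have hlim : Filter.Tendsto (fun N : ℕ => Real.sqrt (4 * (1 / ((N : ℝ) + 1)))) Filter.atTop
      (nhds 0) := by
    have := (tendsto_one_div_add_atTop_nhds_zero_nat (𝕜 := ℝ)).const_mul 4
    simpa using this.sqrt
  have hcauchy : CauchySeq u := by
    refine cauchySeq_of_le_tendsto_0 _ (fun n m N hn hm => ?_) hlim
    rw [dist_eq_norm]
    refine Real.le_sqrt_of_sq_le ?_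
    have h1 : ∀ k, N ≤ k → ∀ g, ‖u k - ρ g 0‖ ^ 2 ≤ r + 1 / ((N : ℝ) + 1) := by
      intro k hk g
      refine ((hle _ g).trans (hu k).le).trans ?_
      have := Nat.one_div_le_one_div (α := ℝ) hk
      linarith
    linarith [hmid _ _ _ (h1 n hn) (h1 m hm)]
  obtain ⟨z, hz⟩ := cauchySeq_tendsto_of_complete hcauchy
  have hzr : ∀ g, ‖z - ρ g 0‖ ^ 2 ≤ r := by
    intro g
    have t1 : Filter.Tendsto (fun k => ‖u k - ρ g 0‖ ^ 2) Filter.atTop (nhds (‖z - ρ g 0‖ ^ 2)) :=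
      ((hz.sub_const _).norm).pow 2
    have t2 : Filter.Tendsto (fun k : ℕ => r + 1 / ((k : ℝ) + 1)) Filter.atTop (nhds r) := by
      simpa using (tendsto_one_div_add_atTop_nhds_zero_nat (𝕜 := ℝ)).const_add r
    exact le_of_tendsto_of_tendsto' t1 t2 fun k => (hle _ g).trans (hu k).le
  refine ⟨z, fun h => ?_⟩
  -- The orbit is invariant, so `ρ h z` is again an optimal centre.
  have h1 : ∀ g, ‖ρ h z - ρ g 0‖ ^ 2 ≤ r := by
    intro g
    have := hzr (h⁻¹ * g)
    rwa [← dist_eq_norm, ← (ρ h).dist_map, ← map_mul_apply, mul_inv_cancel_left,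
      dist_eq_norm] at this
  have h2 := hmid _ _ _ h1 hzr
  rw [sub_self, mul_zero] at h2
  have h3 : ‖ρ h z - z‖ = 0 := by
    have := le_antisymm h2 (sq_nonneg _)
    exact pow_eq_zero_iff (two_ne_zero) |>.1 this
  exact sub_eq_zero.1 (norm_eq_zero.1 h3)

lemma NoFixedPoint.exists_norm_gt (hH : IsHilbert H) (h : NoFixedPoint ρ) (R : ℝ) :
    ∃ g, R < ‖ρ g 0‖ := by
  have := hH.complete
  by_contra hc
  push Not at hc
  exact h (exists_fixedPoint_of_bounded ρ hc)

/-- An element that moves the origin far away moves all points of a ball. -/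
lemma NoFixedPoint.satisfiesTheta (hH : IsHilbert H) (h : NoFixedPoint ρ) :
    (actionStructure ρ).SatisfiesTheta ortH := by
  refine ⟨fun _ => 1, fun _ => one_pos, fun m n hm => ?_⟩
  obtain ⟨g, hg⟩ := h.exists_norm_gt hH (2 * m + 1)
  refine iInf_eq_zero_of_nonneg (fun g => Real.iSup_nonneg fun x => tsub_nonneg _ _) g
    (iSup_eq_zero_of_forall fun (x : Ball H m) => tsub_eq_zero ?_)
  have hx : ‖x.1‖ ≤ m := x.norm_le
  have : 1 ≤ circOf ρ m n g x x := by
    refine one_le_lengthInBall (lt_of_ortH_lt hm) hx ?_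
    have h1 : ‖ρ g 0‖ ≤ ‖x.1‖ + dist (ρ g x.1) x.1 + ‖x.1‖ := by
      have t := dist_triangle4 (ρ g 0) (ρ g x.1) x.1 0
      rw [(ρ g).dist_map, dist_zero_right, dist_zero_left, dist_zero_right] at t
      exact t
    linarith
  rw [Nat.cast_one, div_one]
  exact this

end Action

/-! ### Density characters, handled through index types. -/

section Density

/-- The set `A` lies in the closure of a set that is indexed by `ι`. -/
def SeparableBy (ι : Type*) {X : Type*} [TopologicalSpace X] (A : Set X) : Prop :=
  ∃ f : ι → X, A ⊆ closure (Set.range f)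

lemma exists_surjective_of_lift_mk_le {ι : Type u} {κ : Type v} [Nonempty κ]
    (h : Cardinal.lift.{u} (Cardinal.mk κ) ≤ Cardinal.lift.{v} (Cardinal.mk ι)) :
    ∃ s : ι → κ, Function.Surjective s := by
  obtain ⟨e⟩ := Cardinal.lift_mk_le'.1 h
  exact ⟨Function.invFun e, Function.invFun_surjective e.injective⟩

lemma exists_surjective_prod_nat (ι : Type u) [Infinite ι] :
    ∃ s : ι → ι × ℕ, Function.Surjective s := by
  refine exists_surjective_of_lift_mk_le ?_
  simp

lemma SeparableBy.of_surjective {ι : Type*} {κ : Type*} {X : Type*} [TopologicalSpace X]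
    {A : Set X} (h : SeparableBy κ A) {s : ι → κ} (hs : Function.Surjective s) :
    SeparableBy ι A := by
  obtain ⟨f, hf⟩ := h
  exact ⟨f ∘ s, by rwa [hs.range_comp]⟩

/-- Subspaces of metrizable spaces inherit density. -/
lemma SeparableBy.exists_of_isInducing {ι : Type*} [Infinite ι] {X Y : Type*} [TopologicalSpace X]
    [TopologicalSpace Y] [PseudoMetrizableSpace X] {p : Y → X} (hp : Topology.IsInducing p)
    {A : Set X} (hA : SeparableBy ι A) {B : Set Y} (hB : Set.MapsTo p B A) (hne : B.Nonempty) :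
    ∃ f : ι → Y, (∀ i, f i ∈ B) ∧ B ⊆ closure (Set.range f) := by
  classical
  let _ := pseudoMetrizableSpacePseudoMetric X
  obtain ⟨d, hd⟩ := hA
  obtain ⟨y₀, hy₀⟩ := hne
  -- One point of `B` is chosen for each ball of radius `1 / (n + 1)` around a point of the given
  -- family; `y₀` is the default when the ball misses `B`.
  have pick : ∀ q : ι × ℕ, ∃ y ∈ B, (∃ z ∈ B, dist (p z) (d q.1) < 1 / ((q.2 : ℝ) + 1)) →
      dist (p y) (d q.1) < 1 / ((q.2 : ℝ) + 1) := by
    intro q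
    by_cases h : ∃ z ∈ B, dist (p z) (d q.1) < 1 / ((q.2 : ℝ) + 1)
    · obtain ⟨z, hz, hz'⟩ := h
      exact ⟨z, hz, fun _ => hz'⟩
    · exact ⟨y₀, hy₀, fun h' => absurd h' h⟩
  choose f hfB hf using pick
  obtain ⟨s, hs⟩ := exists_surjective_prod_nat ι
  refine ⟨f ∘ s, fun i => hfB _, fun y hy => ?_⟩
  rw [hs.range_comp, hp.closure_eq_preimage_closure_image, Set.mem_preimage, Metric.mem_closure_iff]
  intro ε hε
  obtain ⟨n, hn⟩ := exists_nat_one_div_lt (half_pos hε)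
  obtain ⟨_, ⟨i, rfl⟩, hi⟩ := Metric.mem_closure_iff.1 (hd (hB hy)) (1 / ((n : ℝ) + 1))
    (by positivity)
  refine ⟨p (f (i, n)), ⟨_, ⟨_, rfl⟩, rfl⟩, ?_⟩
  have := hf (i, n) ⟨y, hy, hi⟩
  have := dist_triangle_right (p y) (p (f (i, n))) (d i)
  linarith

lemma densityCharacter_le {X : Type u} [TopologicalSpace X] {ι : Type u} {f : ι → X}
    (hf : DenseRange f) : densityCharacter X ≤ Cardinal.mk ι :=
  (csInf_le' (s := {κ | ∃ D : Set X, Dense D ∧ Cardinal.mk D = κ})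
    ⟨Set.range f, hf, rfl⟩).trans Cardinal.mk_range_le

lemma exists_dense_mk_eq (X : Type u) [TopologicalSpace X] :
    ∃ D : Set X, Dense D ∧ Cardinal.mk D = densityCharacter X :=
  csInf_mem (s := {κ | ∃ D : Set X, Dense D ∧ Cardinal.mk D = κ})
    ⟨_, Set.univ, dense_univ, rfl⟩

/-- Finite sets are closed. Infinite dense sets can absorb countably many extra indices. -/
lemma _root_.Dense.infinite_of_t1 {X : Type u} [TopologicalSpace X] [T1Space X] [Infinite X]
    {D : Set X} (hD : Dense D) : Infinite D := by
  refine Set.infinite_coe_iff.2 fun hfin => ?_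
  have : D = Set.univ := by rw [← hfin.isClosed.closure_eq, hD.closure_eq]
  exact Set.infinite_univ (this ▸ hfin)

lemma densityCharacter_le_of_isInducing {X Y : Type u} [TopologicalSpace X] [TopologicalSpace Y]
    [MetrizableSpace X] [Infinite X] [Nonempty Y] {p : Y → X} (hp : Topology.IsInducing p) :
    densityCharacter Y ≤ densityCharacter X := by
  obtain ⟨D, hD, hc⟩ := exists_dense_mk_eq X
  have := hD.infinite_of_t1
  have hs : SeparableBy D (Set.univ : Set X) :=
    ⟨Subtype.val, by rw [Subtype.range_coe, hD.closure_eq]⟩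
  obtain ⟨f, -, hf⟩ := hs.exists_of_isInducing hp (Set.mapsTo_univ p Set.univ) Set.univ_nonempty
  rw [← hc]
  exact densityCharacter_le (f := f) (dense_iff_closure_eq.2 (Set.univ_subset_iff.1 hf))

/-- There are only `κ` many finite rational combinations, and their closure is a real subspace since
the rationals are dense. -/
lemma separableBy_span {κ : Type u} [Infinite κ] {H : Type v} [NormedAddCommGroup H]
    [NormedSpace ℝ H] (e : κ → H) :
    SeparableBy κ ((Submodule.span ℝ (Set.range e)).topologicalClosure : Set H) := by
  have hsurj : ∃ s : κ → (κ →₀ ℚ), Function.Surjective s :=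
    exists_surjective_of_lift_mk_le (by simp)
  obtain ⟨s, hs⟩ := hsurj
  refine SeparableBy.of_surjective ?_ hs
  refine ⟨fun c => c.sum fun i q => (q : ℝ) • e i, ?_⟩
  set Q : AddSubgroup H :=
    { carrier := Set.range fun c : κ →₀ ℚ => c.sum fun i q => (q : ℝ) • e i
      zero_mem' := ⟨0, by simp⟩
      add_mem' := by
        rintro _ _ ⟨a, rfl⟩ ⟨b, rfl⟩
        refine ⟨a + b, ?_⟩
        exact Finsupp.sum_add_index' (by simp) (by intros; push_cast; exact add_smul _ _ _)
      neg_mem' := by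
        rintro _ ⟨a, rfl⟩
        refine ⟨-a, ?_⟩
        dsimp only
        rw [Finsupp.sum_neg_index (by simp)]
        simp [Finsupp.sum] } with hQ
  have hsmul : ∀ (q : ℚ) (x : H), x ∈ Q → (q : ℝ) • x ∈ Q := by
    rintro q _ ⟨a, rfl⟩
    refine ⟨q • a, ?_⟩
    dsimp only
    rw [Finsupp.sum_smul_index' (by simp), Finsupp.smul_sum]
    simp [smul_smul]
  set W : Submodule ℝ H :=
    { Q.topologicalClosure with
      smul_mem' := by
        intro r x hx
        have h1 : (r, x) ∈ closure (Set.range ((↑) : ℚ → ℝ) ×ˢ (Q : Set H)) := by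
          rw [closure_prod_eq]
          exact ⟨Rat.denseRange_cast r, hx⟩
        refine map_mem_closure (f := fun z : ℝ × H => z.1 • z.2) (by fun_prop) h1 ?_
        rintro ⟨_, y⟩ ⟨⟨q, rfl⟩, hy⟩
        exact hsmul q y hy } with hW
  have hspan : Submodule.span ℝ (Set.range e) ≤ W := by
    rw [Submodule.span_le]
    rintro _ ⟨i, rfl⟩
    exact subset_closure ⟨Finsupp.single i 1, by simp⟩
  exact closure_minimal hspan isClosed_closure

end Density

/-! ### Restriction to invariant substructures. -/

section Restriction

variable {G : Type u} [Group G] [MetricSpace G]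
  {H : Type v} [NormedAddCommGroup H] [InnerProductSpace ℝ H]

lemma IsMetricGroup.subgroup (hG : IsMetricGroup G) {G₀ : Subgroup G}
    (h : IsClosed (G₀ : Set G)) : IsMetricGroup G₀ where
  dist_mul_left a g h := hG.dist_mul_left a g h
  dist_mul_right a g h := hG.dist_mul_right a g h
  complete := by
    have := hG.complete
    exact h.completeSpace_coe
  bounded := by
    obtain ⟨D, hD⟩ := hG.bounded
    exact ⟨D, fun g h => hD g h⟩

/-- The action of a subgroup on an invariant linear subspace. -/
noncomputable def restrictAction (ρ : G →* (H ≃ᵃⁱ[ℝ] H)) (G₀ : Subgroup G) (H₀ : Submodule ℝ H)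
    (hinv : ∀ g ∈ G₀, ∀ x ∈ H₀, ρ g x ∈ H₀) : G₀ →* (H₀ ≃ᵃⁱ[ℝ] H₀) where
  -- By Mazur–Ulam a bijective isometry of real normed spaces is affine.
  toFun g := IsometryEquiv.toRealAffineIsometryEquiv
    { toFun := fun x => ⟨ρ g x, hinv g g.2 x x.2⟩
      invFun := fun x => ⟨ρ (g : G)⁻¹ x, hinv _ (G₀.inv_mem g.2) x x.2⟩
      left_inv := fun x => Subtype.ext (map_inv_apply_self ρ g x)
      right_inv := fun x => Subtype.ext (map_apply_inv_self ρ g x)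
      isometry_toFun := Isometry.of_dist_eq fun x y => (ρ g).dist_map x y }
  map_one' := by
    ext x
    exact map_one_apply ρ _
  map_mul' g h := by
    ext x
    exact map_mul_apply ρ _ _ _

lemma lengthInBall_coe {H₀ : Submodule ℝ H} (n : ℕ) (a b : H₀) :
    lengthInBall n (a : H) (b : H) = lengthInBall n a b := by
  have himg : segment ℝ (a : H) (b : H) = H₀.subtypeₗᵢ '' segment ℝ a b := by
    have := image_segment ℝ H₀.subtype.toAffineMap a b
    exact this.symm
  rw [lengthInBall, lengthInBall, ← H₀.subtypeₗᵢ.isometry.diam_image, himg]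
  congr 1
  ext y
  constructor
  · rintro ⟨⟨x, hx, rfl⟩, hy⟩
    exact ⟨x, ⟨hx, by simpa using hy⟩, rfl⟩
  · rintro ⟨x, ⟨hx, hx'⟩, rfl⟩
    exact ⟨⟨x, hx, rfl⟩, by simpa using hx'⟩

/-- Lack of fixed points need not survive in a subgroup, but it follows from `hunb`: a fixed `x`
would force `‖ρ g 0‖ ≤ 2 * ‖x‖`. Growth and moduli are inherited as they stand. -/
lemma WitnessesUniform.restrictAction {ρ : G →* (H ≃ᵃⁱ[ℝ] H)} (hρ : WitnessesUniform ρ)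
    {G₀ : Subgroup G} {H₀ : Submodule ℝ H} (hinv : ∀ g ∈ G₀, ∀ x ∈ H₀, ρ g x ∈ H₀)
    (hunb : ∀ n : ℕ, ∃ g ∈ G₀, n < ‖ρ g 0‖) :
    WitnessesUniform (restrictAction ρ G₀ H₀ hinv) where
  noFixedPoint := by
    rintro ⟨x, hx⟩
    obtain ⟨n, hn⟩ := exists_nat_ge (2 * ‖x‖)
    obtain ⟨g, hg, hgn⟩ := hunb n
    have h1 : ρ g x = x := congrArg Subtype.val (hx ⟨g, hg⟩)
    have h2 := dist_triangle (ρ g 0) (ρ g x) 0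
    rw [(ρ g).dist_map, h1, dist_zero_right, dist_zero_left, dist_zero_right] at h2
    have h3 : ‖(x : H)‖ = ‖x‖ := rfl
    linarith
  growth := by
    obtain ⟨gth, hm, hc⟩ := hρ.growth
    exact ⟨gth, hm, fun m δ h0 h1 g hg x hx => hc m δ h0 h1 g hg x hx⟩
  moduli m n hmn := by
    obtain ⟨γ, hγ, hp⟩ := hρ.moduli m n hmn
    exact ⟨γ, hγ, fun ε hε g g' x hx h h' hd => hp ε hε g g' x hx h h' hd⟩

lemma WitnessesUniform.continuous_apply {ρ : G →* (H ≃ᵃⁱ[ℝ] H)} (hG : IsMetricGroup G)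
    (hρ : WitnessesUniform ρ) (x : H) : Continuous fun g => ρ g x := by
  obtain ⟨m, hm⟩ := exists_nat_ge ‖x‖
  obtain ⟨γ, hγ, h⟩ := hρ.exists_modulus hG m
  refine Metric.continuous_iff.2 fun g ε hε => ⟨γ ε, hγ ε hε, fun g' hd => h ε hε _ _ x hm hd⟩

/-- An affine map preserves affine hulls only; `0 ∈ E` puts the translation part `ρ g 0` into the
span, and then the linear part preserves it too. -/
lemma span_orbit_invariant (ρ : G →* (H ≃ᵃⁱ[ℝ] H)) (Γ : Subgroup G) {E : Set H}
    (hE : ∀ g ∈ Γ, ∀ x ∈ E, ρ g x ∈ E) (h0 : 0 ∈ E) {g : G} (hg : g ∈ Γ) {x : H}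
    (hx : x ∈ Submodule.span ℝ E) : ρ g x ∈ Submodule.span ℝ E := by
  have hdec : ∀ y, ρ g y = (ρ g).linear y + ρ g 0 := by
    intro y
    have := (ρ g).toAffineEquiv.map_vadd 0 y
    simpa using this
  have hb : ρ g 0 ∈ Submodule.span ℝ E := Submodule.subset_span (hE g hg 0 h0)
  have hle : Submodule.span ℝ E ≤ (Submodule.span ℝ E).comap ((ρ g).linear : H →ₗ[ℝ] H) := by
    rw [Submodule.span_le]
    intro y hy
    have h1 : ρ g y ∈ Submodule.span ℝ E := Submodule.subset_span (hE g hg y hy)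
    have h2 := Submodule.sub_mem _ h1 hb
    rw [hdec y, add_sub_cancel_right] at h2
    exact h2
  rw [hdec x]
  exact Submodule.add_mem _ (hle hx) hb

/-- Separate continuity suffices: first pass to the limit in the vector, then in the group element.
-/
lemma closure_invariant {ρ : G →* (H ≃ᵃⁱ[ℝ] H)} (hcont : ∀ x, Continuous fun g => ρ g x)
    {Γ : Set G} {V : Set H} (hinv : ∀ g ∈ Γ, ∀ x ∈ V, ρ g x ∈ V) {g : G} (hg : g ∈ closure Γ)
    {x : H} (hx : x ∈ closure V) : ρ g x ∈ closure V := by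
  have h1 : ∀ g ∈ Γ, ρ g x ∈ closure V := fun g hg =>
    map_mem_closure (ρ g).continuous hx (hinv g hg)
  have h2 := map_mem_closure (hcont x) hg h1
  rwa [closure_closure] at h2

end Restriction

/-! ### Small invariant substructures and bountifulness. -/

section Bountiful

lemma SeparableBy.image {ι : Type*} {X Y : Type*} [TopologicalSpace X] [TopologicalSpace Y]
    {A : Set X} (h : SeparableBy ι A) {p : X → Y} (hp : Continuous p) :
    SeparableBy ι (p '' A) := by
  obtain ⟨f, hf⟩ := h
  refine ⟨p ∘ f, ?_⟩
  rw [Set.range_comp]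
  exact (Set.image_mono hf).trans (image_closure_subset_closure_image hp)

lemma SeparableBy.union {ι : Type u} [Infinite ι] {X : Type*} [TopologicalSpace X] {A : Set X}
    {B : ℕ → Set X} (hA : SeparableBy ι A) (hB : ∀ n, SeparableBy ι (B n)) :
    SeparableBy ι (A ∪ ⋃ n, B n) := by
  obtain ⟨s, hs⟩ := exists_surjective_prod_nat ι
  obtain ⟨f, hf⟩ := hA
  choose f' hf' using hB
  refine SeparableBy.of_surjective
    ⟨fun q : ι × ℕ => Nat.casesOn q.2 (f q.1) fun n => f' n q.1, ?_⟩ hs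
  refine Set.union_subset (hf.trans (closure_mono ?_))
    (Set.iUnion_subset fun n => (hf' n).trans (closure_mono ?_))
  · rintro _ ⟨i, rfl⟩
    exact ⟨(i, 0), rfl⟩
  · rintro _ ⟨i, rfl⟩
    exact ⟨(i, n + 1), rfl⟩

lemma exists_linearIndependent_nat {H : Type v} [NormedAddCommGroup H] [InnerProductSpace ℝ H]
    (h : ¬ FiniteDimensional ℝ H) : ∃ b : ℕ → H, LinearIndependent ℝ b := by
  have hinf : Infinite (Module.Basis.ofVectorSpaceIndex ℝ H) := by
    by_contra hf
    rw [not_infinite_iff_finite] at hf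
    exact h (Module.Basis.ofVectorSpace ℝ H).finiteDimensional_of_finite
  let e := Infinite.natEmbedding (Module.Basis.ofVectorSpaceIndex ℝ H)
  exact ⟨_, (Module.Basis.ofVectorSpace ℝ H).linearIndependent.comp e e.injective⟩

lemma IsHilbert.submodule {H : Type v} [NormedAddCommGroup H] [InnerProductSpace ℝ H]
    (hH : IsHilbert H) {H₀ : Submodule ℝ H} (hc : IsClosed (H₀ : Set H)) {b : ℕ → H}
    (hb : LinearIndependent ℝ b) (hmem : ∀ n, b n ∈ H₀) : IsHilbert H₀ where
  complete := by
    have := hH.complete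
    exact hc.completeSpace_coe
  infinite_dim hfin := by
    have hb' : LinearIndependent ℝ fun n => (⟨b n, hmem n⟩ : H₀) :=
      LinearIndependent.of_comp H₀.subtype hb
    exact not_finite_iff_infinite.2 inferInstance hb'.finite_of_isNoetherian

namespace GHStructure

variable {M : GHStructure.{u, v}}

lemma metrizableSpace_univ (hG : IsMetricGroup M.G) (hH : IsHilbert M.H) :
    MetrizableSpace M.Univ := by
  have := hG.complete
  have := hH.complete
  have (n : ℕ) : CompleteSpace (Ball M.H n) := Metric.isClosed_closedBall.completeSpace_coe
  infer_instance

lemma WitnessesUniformNonFH.restrict {ρ : M.G →* (M.H ≃ᵃⁱ[ℝ] M.H)} (hG : IsMetricGroup M.G)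
    (hρ : WitnessesUniform ρ)
    (hcirc : ∀ m n : ℕ, ortH m < n → ∀ g x y, M.circ m n g x y = circOf ρ m n g x y)
    {G₀ : Subgroup M.G} {H₀ : Submodule ℝ M.H} (hG₀ : IsClosed (G₀ : Set M.G))
    (hH₀ : IsHilbert H₀) (hinv : ∀ g ∈ G₀, ∀ x ∈ H₀, ρ g x ∈ H₀)
    (hunb : ∀ n : ℕ, ∃ g ∈ G₀, n < ‖ρ g 0‖) : (M.restrict G₀ H₀).WitnessesUniformNonFH := by
  refine ⟨hG.subgroup hG₀, hH₀, NonFH.restrictAction ρ G₀ H₀ hinv, hρ.restrictAction hinv hunb, ?_⟩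
  intro m n hmn (g : G₀) (x : Ball H₀ m) (y : Ball H₀ m)
  change M.circ m n g x.up y.up = lengthInBall n (NonFH.restrictAction ρ G₀ H₀ hinv g x.1) y.1
  rw [hcirc m n hmn, ← lengthInBall_coe]
  rfl

/-- The universe of a substructure has at most the density of its group and its space. -/
lemma separableBy_carrier {ι : Type*} [Infinite ι] {G₀ : Subgroup M.G} {H₀ : Submodule ℝ M.H}
    (hG₀ : SeparableBy ι (G₀ : Set M.G)) (hH₀ : SeparableBy ι (H₀ : Set M.H)) :
    SeparableBy ι (M.carrier G₀ H₀) := by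
  have hball : ∀ n, SeparableBy ι ((fun x : Ball M.H n => (Sum.inr ⟨n, x⟩ : M.Univ)) ''
      {x : Ball M.H n | x.1 ∈ H₀}) := by
    intro n
    refine SeparableBy.image ?_ (continuous_inr.comp continuous_sigmaMk)
    obtain ⟨f, -, hf⟩ := hH₀.exists_of_isInducing (B := {x : Ball M.H n | x.1 ∈ H₀})
      Topology.IsInducing.subtypeVal (fun x hx => hx) ⟨Ball.zero n, H₀.zero_mem⟩
    exact ⟨f, hf⟩
  obtain ⟨f, hf⟩ := (hG₀.image (continuous_inl (Y := Σ n : ℕ, Ball M.H n))).union hball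
  refine ⟨f, Set.Subset.trans ?_ hf⟩
  rintro (g | ⟨n, x⟩) hp
  · exact Or.inl ⟨g, hp, rfl⟩
  · exact Or.inr (Set.mem_iUnion.2 ⟨n, x, hp, rfl⟩)

lemma isClosed_carrier {G₀ : Subgroup M.G} {H₀ : Submodule ℝ M.H}
    (hG₀ : IsClosed (G₀ : Set M.G)) (hH₀ : IsClosed (H₀ : Set M.H)) :
    IsClosed (M.carrier G₀ H₀) := by
  rw [isClosed_sum_iff]
  refine ⟨hG₀, isClosed_sigma_iff.2 fun n => hH₀.preimage continuous_subtype_val⟩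

end GHStructure

/-- A small set of elements and vectors lies in a small invariant closed substructure. -/
lemma exists_invariant_closed {G : Type u} [Group G] [MetricSpace G] {H : Type v}
    [NormedAddCommGroup H] [InnerProductSpace ℝ H] (hG : IsMetricGroup G)
    {ρ : G →* (H ≃ᵃⁱ[ℝ] H)} (hcont : ∀ x, Continuous fun g => ρ g x) {ι : Type*} [Infinite ι]
    (f : ι → G) (e : ι → H) :
    ∃ (G₀ : Subgroup G) (H₀ : Submodule ℝ H), IsClosed (G₀ : Set G) ∧ IsClosed (H₀ : Set H) ∧
      (∀ i, f i ∈ G₀) ∧ (∀ i, e i ∈ H₀) ∧ (∀ g ∈ G₀, ∀ x ∈ H₀, ρ g x ∈ H₀) ∧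
      SeparableBy ι (G₀ : Set G) ∧ SeparableBy ι (H₀ : Set H) := by
  have := hG.isTopologicalGroup
  set Γ := (FreeGroup.lift f).range with hΓ
  -- The origin is added to the vectors, as the span of the orbits is invariant only if it contains
  -- the orbit of 0.
  let e' : Option ι → H := fun o => o.elim 0 e
  let orb : FreeGroup ι × Option ι → H := fun q => ρ (FreeGroup.lift f q.1) (e' q.2)
  have horb : ∀ g ∈ Γ, ∀ x ∈ Set.range orb, ρ g x ∈ Set.range orb := by
    rintro _ ⟨w, rfl⟩ _ ⟨⟨w', o⟩, rfl⟩
    refine ⟨(w * w', o), ?_⟩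
    simp only [orb]
    rw [map_mul, map_mul_apply]
  have hone : ∀ o, e' o ∈ Set.range orb := fun o => ⟨(1, o), by
    simp only [orb]
    rw [map_one, map_one_apply]⟩
  obtain ⟨s, hs⟩ : ∃ s : ι → FreeGroup ι, Function.Surjective s :=
    exists_surjective_of_lift_mk_le (by simp [Cardinal.mk_freeGroup])
  obtain ⟨t, ht⟩ : ∃ t : ι → FreeGroup ι × Option ι, Function.Surjective t :=
    exists_surjective_of_lift_mk_le (by simp [Cardinal.mk_freeGroup, Cardinal.mk_option])
  refine ⟨Γ.topologicalClosure, (Submodule.span ℝ (Set.range orb)).topologicalClosure,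
    Γ.isClosed_topologicalClosure, Submodule.isClosed_topologicalClosure _, ?_, ?_, ?_, ?_, ?_⟩
  · exact fun i => Γ.le_topologicalClosure ⟨FreeGroup.of i, FreeGroup.lift_apply_of⟩
  · exact fun i => Submodule.le_topologicalClosure _ (Submodule.subset_span (hone (some i)))
  · exact fun g hg x hx => closure_invariant hcont
      (fun g hg x hx => span_orbit_invariant ρ Γ horb (hone none) hg hx) hg hx
  · exact SeparableBy.of_surjective ⟨FreeGroup.lift f, subset_rfl⟩ hs
  · exact SeparableBy.of_surjective (separableBy_span orb) ht

theorem bountiful_witnessesUniformNonFH :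
    Bountiful.{u, v} GHStructure.WitnessesUniformNonFH := by
  classical
  rintro M ⟨hG, hH, ρ, hρ, hcirc⟩ - C hC
  have := GHStructure.metrizableSpace_univ hG hH
  have : Infinite C := hC.to_subtype
  obtain ⟨D, hD, hDc⟩ := exists_dense_mk_eq C
  have := hD.infinite_of_t1
  obtain ⟨b, hb⟩ := exists_linearIndependent_nat hH.infinite_dim
  choose a ha using fun n : ℕ => hρ.noFixedPoint.exists_norm_gt hH n
  obtain ⟨s, hs⟩ : ∃ s : D → D ⊕ ℕ, Function.Surjective s :=
    exists_surjective_of_lift_mk_le (by simp [Cardinal.add_eq_left (Cardinal.aleph0_le_mk D)])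
  -- The generators are the points of `D`, with the neutral element or 0 in place of a point of the
  -- other kind, together with the sequences `a` (for unbounded orbits) and `b` (for infinite
  -- dimension).
  obtain ⟨G₀, H₀, hG₀, hH₀, hf, he, hinv, hsG, hsH⟩ := exists_invariant_closed hG
    (hρ.continuous_apply hG) (ι := D)
    (fun i => (s i).elim (fun d => d.1.1.elim id fun _ => 1) a)
    (fun i => (s i).elim (fun d => d.1.1.elim (fun _ => 0) fun q => q.2.1) b)
  have haG : ∀ n, a n ∈ G₀ := by
    intro n
    obtain ⟨i, hi⟩ := hs (Sum.inr n)
    simpa [hi] using hf i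
  have hbH : ∀ n, b n ∈ H₀ := by
    intro n
    obtain ⟨i, hi⟩ := hs (Sum.inr n)
    simpa [hi] using he i
  have hDcar : ∀ d : D, d.1.1 ∈ M.carrier G₀ H₀ := by
    intro d
    obtain ⟨i, hi⟩ := hs (Sum.inl d)
    have h1 := hf i
    have h2 := he i
    simp only [hi, Sum.elim_inl] at h1 h2
    rcases hd : d.1.1 with g | q
    · rw [hd] at h1
      exact h1
    · rw [hd] at h2
      exact h2
  have hsub : C ⊆ M.carrier G₀ H₀ := by
    intro c hc
    -- Only the dense part `D` was put in; the rest of `C` follows because the carrier is closed.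
    have h1 := map_mem_closure continuous_subtype_val (hD ⟨c, hc⟩) fun d hd => hDcar ⟨d, hd⟩
    rwa [(GHStructure.isClosed_carrier hG₀ hH₀).closure_eq] at h1
  refine ⟨G₀, H₀, GHStructure.WitnessesUniformNonFH.restrict hG hρ hcirc hG₀
    (hH.submodule hH₀ hb hbH) hinv fun n => ⟨a n, haG n, ha n⟩, hsub, le_antisymm ?_ ?_⟩
  · obtain ⟨c⟩ : Nonempty C := inferInstance
    obtain ⟨f, -, hf⟩ := (GHStructure.separableBy_carrier hsG hsH).exists_of_isInducing
      (B := (Set.univ : Set (M.carrier G₀ H₀))) Topology.IsInducing.subtypeVal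
      (fun x _ => x.2) ⟨⟨c, hsub c.2⟩, trivial⟩
    rw [← hDc]
    exact densityCharacter_le (f := f) (dense_iff_closure_eq.2 (Set.univ_subset_iff.1 hf))
  · have : Infinite (M.carrier G₀ H₀) := Infinite.of_injective _ (Set.inclusion_injective hsub)
    exact densityCharacter_le_of_isInducing (p := Set.inclusion hsub)
      (Topology.IsEmbedding.inclusion hsub).isInducing

end Bountiful

end NonFH

/-! ### The theorem. -/

theorem theorem3p15 :
    (∀ (G : Type u) [Group G] [MetricSpace G], NonFH.IsMetricGroup G →
      ∀ (gth : ℕ → ℝ → ℕ) (γ : ℕ → ℕ → ℝ → ℝ), NonFH.NonFHIn.{u, v} gth NonFH.ortH γ G →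
        ∃ (H : Type v) (_ : NormedAddCommGroup H) (_ : InnerProductSpace ℝ H)
          (ρ : G →* (H ≃ᵃⁱ[ℝ] H)),
          (NonFH.actionStructure ρ).InKisoH gth NonFH.ortH γ ∧
            (NonFH.actionStructure ρ).SatisfiesTheta NonFH.ortH) ∧
    (∀ (G : Type u) [Group G] [MetricSpace G], NonFH.IsMetricGroup G →
      NonFH.UniformNonFH.{u, v} G →
        ∃ (gth : ℕ → ℝ → ℕ) (γ : ℕ → ℕ → ℝ → ℝ), NonFH.IsGrowth gth ∧
          ∃ (H : Type v) (_ : NormedAddCommGroup H) (_ : InnerProductSpace ℝ H)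
            (ρ : G →* (H ≃ᵃⁱ[ℝ] H)),
            (NonFH.actionStructure ρ).InKisoH gth NonFH.ortH γ ∧
              (NonFH.actionStructure ρ).SatisfiesTheta NonFH.ortH) ∧
    NonFH.Bountiful.{u, v} NonFH.GHStructure.WitnessesUniformNonFH := by
  refine ⟨?_, ?_, NonFH.bountiful_witnessesUniformNonFH⟩
  · rintro G _ _ - gth γ ⟨H, _, _, ρ, hfix, hK⟩
    exact ⟨H, _, _, ρ, hK, hfix.satisfiesTheta hK.hilbert⟩
  · rintro G _ _ hG ⟨H, _, _, ρ, hH, hρ⟩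
    obtain ⟨gth, γ, hgth, hK⟩ := hρ.exists_inKisoH hG hH
    exact ⟨gth, γ, hgth, H, _, _, ρ, hK, hρ.noFixedPoint.satisfiesTheta hH⟩
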